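/- Let $\mathcal G$ be a metric graph with finite vertex set $\mathcal V$ and finite edge set $\mathcal E$. Every edge $e$ has a length $L_e\in(0,\infty]$ and is identified with $I_e=[0,L_e]$ if $L_e<\infty$ and with $I_e=[0,\infty)$ if $L_e=\infty$. Assume that $\mathcal G$ is non-compact, i.e. at least one edge is infinite. For a vertex $v$ let $d_v$ be the number of ends of edges at $v$ (a loop counts twice). For a function $\psi=(\psi_e)_{e\in\mathcal E}$, $\psi_e:I_e\to\mathbb C$, let $\Psi(v)\in\mathbb C^{d_v}$ be the vector of the boundary values of the $\psi_e$ at $v$, and $\Psi'(v)\in\mathbb C^{d_v}$ the vector of their derivatives at $v$ in the directions pointing away from $v$. Put $L^q(\mathcal G)=\bigoplus_e L^q(I_e)$ and $H^k(\mathcal G)=\bigoplus_e H^k(I_e)$. For each $v$ let $A_v,B_v$ be complex $d_v\times d_v$ matrices such that the operator $\operatorname H\psi=(-\psi_e'')_{e\in\mathcal E}$ on $L^2(\mathcal G)$ with domain $D(\operatorname H)=\{\psi\in H^2(\mathcal G): A_v\Psi(v)+B_v\Psi'(v)=0\ \text{for all } v\in\mathcal V\}$ is self-adjoint. Let $P_{D,v}$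 and $P_{N,v}$ be the orthogonal projections of $\mathbb C^{d_v}$ onto $\ker B_v$ and $\ker A_v$, let $P_{R,v}=I-P_{D,v}-P_{N,v}$, and let $\Lambda_v$ be the linear map on $P_{R,v}\mathbb C^{d_v}$ such that $A_vx+B_v\Lambda_vx=0$; thus the vertex conditions read $P_{D,v}\Psi(v)=0$, $P_{N,v}\Psi'(v)=0$, $P_{R,v}\Psi'(v)=\Lambda_vP_{R,v}\Psi(v)$. The quadratic form of $\operatorname H$ is $$Q_{\operatorname H}(\psi)=\|\psi'\|_{L^2(\mathcal G)}^2+\sum_{v\in\mathcal V}\langle\Lambda_vP_{R,v}\Psi(v),P_{R,v}\Psi(v)\rangle_{\mathbb C^{d_v}},\qquad D(Q_{\operatorname H})=\{\psi\in H^1(\mathcal G): P_{D,v}\Psi(v)=0\ \text{for all } v\in\mathcal V\},$$ and the bottom of its spectrum is $l_{\operatorname H}=\inf\{Q_{\operatorname H}(\psi):\psi\in D(Q_{\operatorname H}),\ \|\psi\|_{L^2(\mathcal G)}=1\}$. Let $p>1$ and $\omega\in\mathbb R$. For $\psi\in D(Q_{\operatorname H})$ let $$S_\omega(\psi)=E(\psi)+\omega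 M(\psi),\qquad E(\psi)=\tfrac12Q_{\operatorname H}(\psi)+\tfrac1{p+1}\|\psi\|_{L^{p+1}(\mathcal G)}^{p+1},\qquad M(\psi)=\tfrac12\|\psi\|_{L^2(\mathcal G)}^2 .$$ An action ground state is a minimizer $\psi\not\equiv0$ of $S_\omega$ over $D(Q_{\operatorname H})$. **Theorem.** (i) If $\omega\neq0$, then an action ground state exists if and only if $l_{\operatorname H}<0$ and $\omega\in(0,-l_{\operatorname H})$. (ii) If $\omega=0$ and $p\in(1,5)$, then an action ground state exists if and only if $l_{\operatorname H}<0$. -/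

import Mathlib

open MeasureTheory
open scoped ENNReal

noncomputable section

/-- A metric graph with vertex set `V` and edge set `E`. The edge `e` has length
`length e ∈ (0, ∞]`. Its coordinate `x` runs from the vertex `source e` (at `x = 0`) to the
vertex `target e` (at `x = length e`); an infinite edge has no second endpoint.
Loops and multiple edges are allowed. -/
structure MetricGraph (V E : Type*) where
  length : E → ℝ≥0∞
  length_pos : ∀ e, 0 < length e
  source : E → V
  target : {e : E // length e ≠ ⊤} → V

/-- `g ∈ L²(I)` is the derivative of `f ∈ L²(I)`, where `I` is an interval with left endpoint `0`
and `f` is its absolutely continuous representative (up to the endpoints of `I`). -/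
def HasL2DerivOn (I : Set ℝ) (f g : ℝ → ℂ) : Prop :=
  MemLp f 2 (volume.restrict I) ∧ MemLp g 2 (volume.restrict I) ∧
    ∀ x ∈ I, f x = f 0 + ∫ t in (0 : ℝ)..x, g t

namespace MetricGraph

variable {V E : Type*} (G : MetricGraph V E)

/-- The interval `I_e`: `[0, L_e]` for a finite edge and `[0, ∞)` for an infinite one. -/
def interval (e : E) : Set ℝ := {x | 0 ≤ x ∧ ENNReal.ofReal x ≤ G.length e}

theorem intervalIntegrable_of_memLp {e : E} {g : ℝ → ℂ}
    (hg : MemLp g 2 (volume.restrict (G.interval e))) {x : ℝ} (hx : x ∈ G.interval e) :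
    IntervalIntegrable g volume 0 x := by
  rw [intervalIntegrable_iff_integrableOn_Ioc_of_le hx.1]
  have hsub : Set.Ioc 0 x ⊆ G.interval e := fun y hy =>
    ⟨hy.1.le, (ENNReal.ofReal_le_ofReal hy.2).trans hx.2⟩
  have h2 : MemLp g 2 (volume.restrict (Set.Ioc 0 x)) :=
    hg.mono_measure (Measure.restrict_mono hsub le_rfl)
  exact h2.integrable (by norm_num)

theorem hasL2DerivOn_zero (I : Set ℝ) : HasL2DerivOn I (fun _ => 0) (fun _ => 0) :=
  ⟨MemLp.zero, MemLp.zero, by simp⟩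

theorem hasL2DerivOn_add {e : E} {f g f₁ g₁ : ℝ → ℂ} (h : HasL2DerivOn (G.interval e) f g)
    (h₁ : HasL2DerivOn (G.interval e) f₁ g₁) :
    HasL2DerivOn (G.interval e) (fun x => f x + f₁ x) (fun x => g x + g₁ x) := by
  refine ⟨h.1.add h₁.1, h.2.1.add h₁.2.1, fun x hx => ?_⟩
  rw [intervalIntegral.integral_add (G.intervalIntegrable_of_memLp h.2.1 hx)
    (G.intervalIntegrable_of_memLp h₁.2.1 hx)]
  simp only
  rw [h.2.2 x hx, h₁.2.2 x hx]
  ring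

theorem hasL2DerivOn_smul {I : Set ℝ} {f g : ℝ → ℂ} (c : ℂ) (h : HasL2DerivOn I f g) :
    HasL2DerivOn I (fun x => c * f x) (fun x => c * g x) := by
  refine ⟨h.1.const_mul c, h.2.1.const_mul c, fun x hx => ?_⟩
  rw [intervalIntegral.integral_const_mul]
  simp only
  rw [h.2.2 x hx]
  ring

/-- The graph is non-compact: some edge is infinite. -/
def NonCompact : Prop := ∃ e, G.length e = ⊤

/-- The ends of edges that sit at a vertex: the initial end of every edge, and the terminal end of
every finite edge. -/
abbrev EdgeEnd : Type _ := E ⊕ {e : E // G.length e ≠ ⊤}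

/-- The vertex at which an end of an edge sits. -/
def vertexOf : G.EdgeEnd → V := Sum.elim G.source G.target

/-- The set `J_v` of the ends of edges at `v`; a loop at `v` contributes both of its ends. Its
cardinality is the degree `d_v`. -/
abbrev J (v : V) : Type _ := {a : G.EdgeEnd // G.vertexOf a = v}

instance (v : V) : DecidableEq (G.J v) := Classical.decEq _

instance [Fintype E] (v : V) : Fintype (G.J v) := Fintype.ofFinite _

/-- The boundary values at `v` of a function on the graph: the vector `Ψ(v)`. -/
def bdryVal (ψ : E → ℝ → ℂ) (v : V) : EuclideanSpace ℂ (G.J v) :=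
  WithLp.toLp 2 fun a =>
    Sum.elim (fun e => ψ e 0) (fun e => ψ e.1 (G.length e.1).toReal) a.1

/-- The derivatives at `v`, taken in the directions away from `v`: the vector `Ψ'(v)`. Here `ψ'` is
the derivative of the function on the graph with respect to the edge coordinates. -/
def bdryDeriv (ψ' : E → ℝ → ℂ) (v : V) : EuclideanSpace ℂ (G.J v) :=
  WithLp.toLp 2 fun a =>
    Sum.elim (fun e => ψ' e 0) (fun e => -ψ' e.1 (G.length e.1).toReal) a.1

theorem bdryVal_zero (v : V) : G.bdryVal (fun _ _ => 0) v = 0 := by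
  ext ⟨a, ha⟩
  rcases a with e | e <;> simp [bdryVal]

theorem bdryDeriv_zero (v : V) : G.bdryDeriv (fun _ _ => 0) v = 0 := by
  ext ⟨a, ha⟩
  rcases a with e | e <;> simp [bdryDeriv]

theorem bdryVal_add (f g : E → ℝ → ℂ) (v : V) :
    G.bdryVal (fun e x => f e x + g e x) v = G.bdryVal f v + G.bdryVal g v := by
  ext ⟨a, ha⟩
  rcases a with e | e <;> simp [bdryVal]

theorem bdryDeriv_add (f g : E → ℝ → ℂ) (v : V) :
    G.bdryDeriv (fun e x => f e x + g e x) v = G.bdryDeriv f v + G.bdryDeriv g v := by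
  ext ⟨a, ha⟩
  rcases a with e | e <;> simp [bdryDeriv, add_comm]

theorem bdryVal_smul (c : ℂ) (f : E → ℝ → ℂ) (v : V) :
    G.bdryVal (fun e x => c * f e x) v = c • G.bdryVal f v := by
  ext ⟨a, ha⟩
  rcases a with e | e <;> simp [bdryVal]

theorem bdryDeriv_smul (c : ℂ) (f : E → ℝ → ℂ) (v : V) :
    G.bdryDeriv (fun e x => c * f e x) v = c • G.bdryDeriv f v := by
  ext ⟨a, ha⟩
  rcases a with e | e <;> simp [bdryDeriv]

variable [Fintype E]

/-- The Hilbert space `L²(𝒢) = ⨁ₑ L²(I_e)`. -/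
abbrev L2 : Type _ := PiLp 2 fun e : E => Lp ℂ 2 (volume.restrict (G.interval e))

section VertexConditions

variable (A B : ∀ v : V, Matrix (G.J v) (G.J v) ℂ)

/-- The linear map on `ℂ^{d_v}` given by the matrix `A_v`. -/
abbrev vMap (v : V) : EuclideanSpace ℂ (G.J v) →ₗ[ℂ] EuclideanSpace ℂ (G.J v) :=
  Matrix.toEuclideanLin (A v)

/-- The graph of the Hamiltonian: all pairs `(ψ, -ψ'')` with `ψ ∈ H²(𝒢)` and
`A_v Ψ(v) + B_v Ψ'(v) = 0` at every vertex `v`. -/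
def hamiltonianGraph : Submodule ℂ (G.L2 × G.L2) where
  carrier := {u | ∃ ψ ψ' ψ'' : E → ℝ → ℂ,
    (∀ e, HasL2DerivOn (G.interval e) (ψ e) (ψ' e)) ∧
    (∀ e, HasL2DerivOn (G.interval e) (ψ' e) (ψ'' e)) ∧
    (∀ v, G.vMap A v (G.bdryVal ψ v) + G.vMap B v (G.bdryDeriv ψ' v) = 0) ∧
    (∀ e, (u.1 e : ℝ → ℂ) =ᵐ[volume.restrict (G.interval e)] ψ e) ∧
    (∀ e, (u.2 e : ℝ → ℂ) =ᵐ[volume.restrict (G.interval e)] fun x => -ψ'' e x)}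
  zero_mem' := by
    refine ⟨fun _ _ => 0, fun _ _ => 0, fun _ _ => 0, fun _ => hasL2DerivOn_zero _,
      fun _ => hasL2DerivOn_zero _, fun v => ?_, fun e => ?_, fun e => ?_⟩
    · rw [G.bdryVal_zero, G.bdryDeriv_zero]
      simp
    · exact Lp.coeFn_zero _ _ _
    · simp only [neg_zero]
      exact Lp.coeFn_zero _ _ _
  add_mem' := by
    rintro u w ⟨f, f', f'', h1, h2, h3, h4, h5⟩ ⟨g, g', g'', k1, k2, k3, k4, k5⟩
    refine ⟨fun e x => f e x + g e x, fun e x => f' e x + g' e x, fun e x => f'' e x + g'' e x,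
      fun e => G.hasL2DerivOn_add (h1 e) (k1 e), fun e => G.hasL2DerivOn_add (h2 e) (k2 e),
      fun v => ?_, fun e => ?_, fun e => ?_⟩
    · rw [G.bdryVal_add, G.bdryDeriv_add, map_add, map_add, add_add_add_comm, h3, k3, add_zero]
    · filter_upwards [Lp.coeFn_add (u.1 e) (w.1 e), h4 e, k4 e] with x hx hx1 hx2
      simp only [Prod.fst_add, PiLp.add_apply]
      rw [hx, Pi.add_apply, hx1, hx2]
    · filter_upwards [Lp.coeFn_add (u.2 e) (w.2 e), h5 e, k5 e] with x hx hx1 hx2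
      simp only [Prod.snd_add, PiLp.add_apply]
      rw [hx, Pi.add_apply, hx1, hx2]
      ring
  smul_mem' := by
    rintro c u ⟨f, f', f'', h1, h2, h3, h4, h5⟩
    refine ⟨fun e x => c * f e x, fun e x => c * f' e x, fun e x => c * f'' e x,
      fun e => hasL2DerivOn_smul c (h1 e), fun e => hasL2DerivOn_smul c (h2 e),
      fun v => ?_, fun e => ?_, fun e => ?_⟩
    · rw [G.bdryVal_smul, G.bdryDeriv_smul, map_smul, map_smul, ← smul_add, h3, smul_zero]
    · filter_upwards [Lp.coeFn_smul c (u.1 e), h4 e] with x hx hx1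
      simp only [Prod.smul_fst, PiLp.smul_apply]
      rw [hx, Pi.smul_apply, hx1, smul_eq_mul]
    · filter_upwards [Lp.coeFn_smul c (u.2 e), h5 e] with x hx hx1
      simp only [Prod.smul_snd, PiLp.smul_apply]
      rw [hx, Pi.smul_apply, hx1, smul_eq_mul]
      ring

/-- The Hamiltonian `H : L²(𝒢) → L²(𝒢)`, `H ψ = (-ψ_e'')_e`, an unbounded operator with domain
`D(H) = {ψ ∈ H²(𝒢) : A_v Ψ(v) + B_v Ψ'(v) = 0 for all v}`. -/
def hamiltonian : G.L2 →ₗ.[ℂ] G.L2 := (G.hamiltonianGraph A B).toLinearPMap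

/-- The Dirichlet projector `P_{D,v}`: the orthogonal projection onto `ker B_v`. -/
def projD (v : V) : EuclideanSpace ℂ (G.J v) →L[ℂ] EuclideanSpace ℂ (G.J v) :=
  (LinearMap.ker (G.vMap B v)).starProjection

/-- The Neumann projector `P_{N,v}`: the orthogonal projection onto `ker A_v`. -/
def projN (v : V) : EuclideanSpace ℂ (G.J v) →L[ℂ] EuclideanSpace ℂ (G.J v) :=
  (LinearMap.ker (G.vMap A v)).starProjection

/-- The Robin projector `P_{R,v} = 1 - P_{D,v} - P_{N,v}`. -/
def projR (v : V) : EuclideanSpace ℂ (G.J v) →L[ℂ] EuclideanSpace ℂ (G.J v) :=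
  1 - G.projD B v - G.projN A v

/-- The Robin matrix `Λ_v = -B_v⁻¹ A_v`, where `B_v` is inverted on `(ker B_v)ᗮ`, on which it is
injective. Only its values on the range of `P_{R,v}` matter: for self-adjoint conditions,
`Λ_v` maps this range to itself, and `y = Λ_v x` is the unique solution of `A_v x + B_v y = 0` in it,
so that the vertex conditions read
`P_{D,v} Ψ(v) = 0`, `P_{N,v} Ψ'(v) = 0`, `P_{R,v} Ψ'(v) = Λ_v P_{R,v} Ψ(v)`. -/
def robin (v : V) : EuclideanSpace ℂ (G.J v) →ₗ[ℂ] EuclideanSpace ℂ (G.J v) :=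
  -((LinearMap.ker (G.vMap B v))ᗮ.subtype ∘ₗ
    ((G.vMap B v).domRestrict (LinearMap.ker (G.vMap B v))ᗮ).leftInverse ∘ₗ G.vMap A v)

/-- The form domain `D(Q_H) = {ψ ∈ H¹(𝒢) : P_{D,v} Ψ(v) = 0 for all v}`. -/
def formDomain : Set (E → ℝ → ℂ) :=
  {ψ | (∀ e, ∃ g, HasL2DerivOn (G.interval e) (ψ e) g) ∧ ∀ v, G.projD B v (G.bdryVal ψ v) = 0}

/-- The integral `‖ψ‖_{L^q(𝒢)}^q`. -/
def lpPow (q : ℝ) (ψ : E → ℝ → ℂ) : ℝ := ∑ e, ∫ x in G.interval e, ‖ψ e x‖ ^ q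

/-- The quadratic form
`Q_H(ψ) = ‖ψ'‖²_{L²(𝒢)} + ∑_v ⟨Λ_v P_{R,v} Ψ(v), P_{R,v} Ψ(v)⟩`. -/
def form [Fintype V] (ψ : E → ℝ → ℂ) : ℝ :=
  G.lpPow 2 (fun e => deriv (ψ e)) +
    ∑ v, RCLike.re (inner ℂ (G.robin A B v (G.projR A B v (G.bdryVal ψ v)))
      (G.projR A B v (G.bdryVal ψ v)))

/-- The bottom of the spectrum: the infimum, in the extended reals, of `Q_H` over the functions in
`D(Q_H)` with `‖ψ‖_{L²(𝒢)} = 1`. -/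
def specBottom [Fintype V] : EReal :=
  ⨅ ψ ∈ {ψ | ψ ∈ G.formDomain B ∧ G.lpPow 2 ψ = 1}, (G.form A B ψ : EReal)

/-- The energy `E(ψ) = Q_H(ψ)/2 + ‖ψ‖_{L^{p+1}}^{p+1}/(p+1)`. -/
def energy [Fintype V] (p : ℝ) (ψ : E → ℝ → ℂ) : ℝ :=
  1 / 2 * G.form A B ψ + 1 / (p + 1) * G.lpPow (p + 1) ψ

/-- The mass `M(ψ) = ‖ψ‖²_{L²}/2`. -/
def mass (ψ : E → ℝ → ℂ) : ℝ := 1 / 2 * G.lpPow 2 ψ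

/-- The action `S_ω = E + ω M`. -/
def action [Fintype V] (p ω : ℝ) (ψ : E → ℝ → ℂ) : ℝ :=
  G.energy A B p ψ + ω * G.mass ψ

/-- An action ground state: a minimizer of `S_ω` over `D(Q_H)` that is not identically zero on the
graph. -/
def IsActionGroundState [Fintype V] (p ω : ℝ) (ψ : E → ℝ → ℂ) : Prop :=
  ψ ∈ G.formDomain B ∧ (∃ e, ∃ x ∈ G.interval e, ψ e x ≠ 0) ∧
    IsMinOn (G.action A B p ω) (G.formDomain B) ψ

end VertexConditions

end MetricGraph

end

open Filter Topology MetricGraph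

noncomputable section

/-! Necessity is a comparison with the zero function, whose action is `0`. A ground state has
nonpositive action but a strictly positive `L^{p+1}` term, so its quadratic part is negative, which
gives `l_H < -ω` (`specBottom_lt_of_isActionGroundState`). A negative `ω` is impossible on a
non-compact graph, because a small profile spread over a half-line drives the action to `-∞`
(`not_bddBelow_action`).

For sufficiency, let `ω ≥ 0`. The action is a convex functional of `ψ` (Dirichlet integral plus
`density`) and a possibly indefinite quadratic form in the finitely many boundary values. A trace
inequality makes the action coercive (`exists_coercive`), so along a minimizing sequence the
boundary values converge after passing to a subsequence. Once they do, the boundary form behaves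
like a constant, and comparing two members of the sequence with their midpoint forces the
derivatives to be Cauchy in `L²` (`sum_integral_norm_sub_sq_le`). The functions then converge
pointwise, and Fatou's lemma gives a limit of minimal action, so no analysis of escaping mass is
needed (`exists_relaxed_minimizer`).

The limit has finite density, but might not be square integrable. For `ω > 0` the density controls
`‖ψ‖²`. For `ω = 0`, the limit is replaced on each infinite edge by the explicit solution
`r(1+cx)^{-2/(p-1)}` of `w'' = w^p`, up to a phase, with the same value at the vertex. By convexity
this does not raise the action, and the profile is in `L²` because `p < 5` (`exists_profile`).
Finally, if `l_H < -ω`, a small multiple of a suitable test function has negative action, since `p +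
1 > 2`; hence the minimizer is not zero. -/

/-! ### Elementary inequalities and integration lemmas. -/

theorem sq_le_mul_rpow_add {q : ℝ} (hq : 2 < q) {η : ℝ} (hη : 0 < η) :
    ∃ C, 0 ≤ C ∧ ∀ t : ℝ, 0 ≤ t → t ^ 2 ≤ η * t ^ q + C := by
  have h1 : Tendsto (fun T : ℝ => η * T ^ (q - 2)) atTop atTop :=
    (tendsto_rpow_atTop (by linarith)).const_mul_atTop hη
  obtain ⟨T, hT1, hT0⟩ := ((h1.eventually_ge_atTop 1).and (eventually_gt_atTop 0)).exists
  refine ⟨T ^ 2, sq_nonneg _, fun t ht => ?_⟩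
  have h3 : 0 ≤ η * t ^ q := by positivity
  rcases le_total t T with h | h
  · nlinarith
  · have ht0 : 0 < t := hT0.trans_le h
    have h4 : t ^ q = t ^ (q - 2) * t ^ 2 := by
      rw [← Real.rpow_natCast t 2, ← Real.rpow_add ht0]
      norm_num
    have h5 : 1 ≤ η * t ^ (q - 2) :=
      hT1.trans (mul_le_mul_of_nonneg_left (Real.rpow_le_rpow hT0.le h (by linarith)) hη.le)
    rw [h4, ← mul_assoc]
    nlinarith [sq_nonneg t, sq_nonneg T]

theorem norm_toLp_two_sq {μ : Measure ℝ} {f : ℝ → ℂ} (hf : MemLp f 2 μ) :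
    ‖hf.toLp f‖ ^ 2 = ∫ x, ‖f x‖ ^ 2 ∂μ := by
  have h := @L2.inner_def ℝ ℂ ℂ _ _ _ _ _ (hf.toLp f) (hf.toLp f)
  rw [inner_self_eq_norm_sq_to_K] at h
  have h2 : ((‖hf.toLp f‖ ^ 2 : ℝ) : ℂ) = ((∫ x, ‖f x‖ ^ 2 ∂μ : ℝ) : ℂ) := by
    push_cast
    rw [← integral_complex_ofReal]
    refine h.trans (integral_congr_ae ?_)
    filter_upwards [hf.coeFn_toLp] with x hx
    rw [hx, inner_self_eq_norm_sq_to_K]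
    simp
  exact_mod_cast h2

theorem sq_norm_setIntegral_le {s : Set ℝ} (hs : volume s ≠ ⊤) {g : ℝ → ℂ}
    (hg : MemLp g 2 (volume.restrict s)) :
    ‖∫ x in s, g x‖ ^ 2 ≤ volume.real s * ∫ x in s, ‖g x‖ ^ 2 := by
  have : IsFiniteMeasure (volume.restrict s) := ⟨by simpa using hs.lt_top⟩
  have hg1 : Integrable g (volume.restrict s) := hg.integrable (by norm_num)
  have hg2 : Integrable (fun x => ‖g x‖ ^ 2) (volume.restrict s) :=
    (memLp_two_iff_integrable_sq_norm hg.1).1 hg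
  set a := ∫ x in s, ‖g x‖ with ha
  have h0 : ‖∫ x in s, g x‖ ≤ a := norm_integral_le_integral_norm _
  -- Cauchy–Schwarz by the discriminant of the quadratic polynomial `t ↦ ∫ (‖g‖ - t)²`.
  have key : ∀ t : ℝ, 0 ≤ (∫ x in s, ‖g x‖ ^ 2) - 2 * t * a + t ^ 2 * volume.real s := by
    intro t
    have h1 : 0 ≤ ∫ x in s, (‖g x‖ - t) ^ 2 := integral_nonneg fun x => sq_nonneg _
    have h2 : ∫ x in s, (‖g x‖ - t) ^ 2 =
        (∫ x in s, ‖g x‖ ^ 2) - 2 * t * a + t ^ 2 * volume.real s := by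
      have : ∀ x, (‖g x‖ - t) ^ 2 = ‖g x‖ ^ 2 - 2 * t * ‖g x‖ + t ^ 2 := fun x => by ring
      simp_rw [this]
      have hd : Integrable (fun x => ‖g x‖ ^ 2 - 2 * t * ‖g x‖) (volume.restrict s) :=
        hg2.sub (hg1.norm.const_mul _)
      rw [integral_add hd (integrable_const _),
        integral_sub hg2 (hg1.norm.const_mul _), integral_const_mul, integral_const]
      simp [mul_comm, ha]
    rwa [h2] at h1
  have h3 : a ^ 2 ≤ volume.real s * ∫ x in s, ‖g x‖ ^ 2 := by
    have h4 : discrim (volume.real s) (-2 * a) (∫ x in s, ‖g x‖ ^ 2) ≤ 0 :=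
      discrim_le_zero fun t => by nlinarith [key t]
    rw [discrim] at h4
    nlinarith
  exact (pow_le_pow_left₀ (norm_nonneg _) h0 2).trans h3

/-- Fatou's lemma for Bochner integrals. Integrability of the limit is part of the conclusion
because nothing else is known about the limit of a minimizing sequence. -/
theorem integrable_and_integral_le_of_tendsto {α : Type*} [MeasurableSpace α] {μ : Measure α}
    {F : ℕ → α → ℝ} {f : α → ℝ} {t : ℝ} (hF : ∀ n, Integrable (F n) μ)
    (hF0 : ∀ n x, 0 ≤ F n x) (hFf : ∀ᵐ x ∂μ, Tendsto (fun n => F n x) atTop (𝓝 (f x)))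
    (ht : Tendsto (fun n => ∫ x, F n x ∂μ) atTop (𝓝 t)) :
    Integrable f μ ∧ ∫ x, f x ∂μ ≤ t := by
  have hm : AEStronglyMeasurable f μ := aestronglyMeasurable_of_tendsto_ae _ (fun n => (hF n).1) hFf
  have hf0 : 0 ≤ᵐ[μ] f := by
    filter_upwards [hFf] with x hx
    exact ge_of_tendsto' hx fun n => hF0 n x
  have ht0 : 0 ≤ t := ge_of_tendsto' ht fun n => integral_nonneg (hF0 n)
  have h1 : ∫⁻ x, ENNReal.ofReal (f x) ∂μ ≤ ENNReal.ofReal t := by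
    calc ∫⁻ x, ENNReal.ofReal (f x) ∂μ
        = ∫⁻ x, liminf (fun n => ENNReal.ofReal (F n x)) atTop ∂μ := by
          refine lintegral_congr_ae ?_
          filter_upwards [hFf] with x hx
          exact ((ENNReal.continuous_ofReal.tendsto _).comp hx).liminf_eq.symm
      _ ≤ liminf (fun n => ∫⁻ x, ENNReal.ofReal (F n x) ∂μ) atTop :=
          lintegral_liminf_le' fun n => (hF n).1.aemeasurable.ennreal_ofReal
      _ = liminf (fun n => ENNReal.ofReal (∫ x, F n x ∂μ)) atTop := by
          congr 1
          ext n
          rw [ofReal_integral_eq_lintegral_ofReal (hF n) (Eventually.of_forall (hF0 n))]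
      _ = ENNReal.ofReal t := ((ENNReal.continuous_ofReal.tendsto _).comp ht).liminf_eq
  refine ⟨⟨hm, ?_⟩, ?_⟩
  · rw [hasFiniteIntegral_iff_ofReal hf0]
    exact h1.trans_lt ENNReal.ofReal_lt_top
  · rw [integral_eq_lintegral_of_nonneg_ae hf0 hm]
    exact ENNReal.toReal_le_of_le_ofReal ht0 h1

/-! ### One edge: regularity and trace estimates. -/

namespace MetricGraph

variable {V E : Type*} (G : MetricGraph V E)

theorem interval_eq_Icc {e : E} (h : G.length e ≠ ⊤) :
    G.interval e = Set.Icc 0 (G.length e).toReal := by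
  ext x
  simp only [interval, Set.mem_ofPred_eq, Set.mem_Icc]
  refine and_congr_right fun hx => ?_
  rw [ENNReal.ofReal_le_iff_le_toReal h]

theorem interval_eq_Ici {e : E} (h : G.length e = ⊤) : G.interval e = Set.Ici 0 := by
  ext x
  simp [interval, h]

theorem measurableSet_interval (e : E) : MeasurableSet (G.interval e) := by
  by_cases h : G.length e = ⊤
  · rw [G.interval_eq_Ici h]
    exact measurableSet_Ici
  · rw [G.interval_eq_Icc h]
    exact measurableSet_Icc

theorem Icc_subset_interval {e : E} {x y : ℝ} (hx : x ∈ G.interval e) (hy : y ∈ G.interval e) :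
    Set.Icc x y ⊆ G.interval e := fun _ hz =>
  ⟨hx.1.trans hz.1, (ENNReal.ofReal_le_ofReal hz.2).trans hy.2⟩

theorem zero_mem_interval (e : E) : (0 : ℝ) ∈ G.interval e := ⟨le_rfl, by simp⟩

theorem length_mem_interval {e : E} (h : G.length e ≠ ⊤) : (G.length e).toReal ∈ G.interval e := by
  rw [G.interval_eq_Icc h]
  exact ⟨ENNReal.toReal_nonneg, le_rfl⟩

theorem exists_pos_mem_interval (e : E) {ε : ℝ} (hε : 0 < ε) :
    ∃ δ, 0 < δ ∧ δ ≤ ε ∧ δ ∈ G.interval e := by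
  by_cases h : G.length e = ⊤
  · exact ⟨ε, hε, le_rfl, by rw [G.interval_eq_Ici h]; exact hε.le⟩
  · have hL : 0 < (G.length e).toReal := ENNReal.toReal_pos (G.length_pos e).ne' h
    refine ⟨min ε (G.length e).toReal, lt_min hε hL, min_le_left _ _, ?_⟩
    rw [G.interval_eq_Icc h]
    exact ⟨(lt_min hε hL).le, min_le_right _ _⟩

/-- Edge functions are defined on all of `ℝ` with arbitrary values off the edge; at interior points
this does not affect the two-sided `deriv` that enters `form`. -/
theorem ae_interval_mem_nhds (e : E) :
    ∀ᵐ x ∂volume.restrict (G.interval e), G.interval e ∈ 𝓝 x := by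
  have h0 : ∀ᵐ x : ℝ, x ≠ 0 := by simp [ae_iff, measure_singleton]
  have hL : ∀ᵐ x : ℝ, x ≠ (G.length e).toReal := by simp [ae_iff, measure_singleton]
  filter_upwards [ae_restrict_mem (G.measurableSet_interval e), ae_restrict_of_ae h0,
    ae_restrict_of_ae hL] with x hx h0 hL
  by_cases h : G.length e = ⊤
  · rw [G.interval_eq_Ici h] at hx ⊢
    exact Ici_mem_nhds (lt_of_le_of_ne hx h0.symm)
  · rw [G.interval_eq_Icc h] at hx ⊢
    exact Icc_mem_nhds (lt_of_le_of_ne hx.1 h0.symm) (lt_of_le_of_ne hx.2 hL)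

/-- `g ∈ L²(I_e)` is the derivative of `f`, which need not be square integrable. -/
def HasDerivOnEdge (e : E) (f g : ℝ → ℂ) : Prop :=
  MemLp g 2 (volume.restrict (G.interval e)) ∧
    ∀ x ∈ G.interval e, f x = f 0 + ∫ t in (0 : ℝ)..x, g t

variable {G} {e : E} {f g : ℝ → ℂ}

/-- Hölder continuity of exponent `1/2`, by Cauchy–Schwarz on the interval between the two points.
Square integrability of `f` plays no role, so the bound also serves the relaxed problem. -/
theorem HasDerivOnEdge.norm_sub_sq_le (h : G.HasDerivOnEdge e f g) {x y : ℝ}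
    (hx : x ∈ G.interval e) (hy : y ∈ G.interval e) :
    ‖f y - f x‖ ^ 2 ≤ |y - x| * ∫ t in G.interval e, ‖g t‖ ^ 2 := by
  wlog hxy : x ≤ y generalizing x y
  · rw [norm_sub_rev, abs_sub_comm]
    exact this hy hx (le_of_not_ge hxy)
  have hsub : Set.Ioc x y ⊆ G.interval e :=
    Set.Ioc_subset_Icc_self.trans (G.Icc_subset_interval hx hy)
  have h1 : f y - f x = ∫ t in Set.Ioc x y, g t := by
    rw [h.2 y hy, h.2 x hx, add_sub_add_left_eq_sub,
      intervalIntegral.integral_interval_sub_left (G.intervalIntegrable_of_memLp h.1 hy)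
        (G.intervalIntegrable_of_memLp h.1 hx), intervalIntegral.integral_of_le hxy]
  have h2 := sq_norm_setIntegral_le (s := Set.Ioc x y) (by simp)
    (h.1.mono_measure (Measure.restrict_mono hsub le_rfl))
  rw [h1, abs_of_nonneg (sub_nonneg.2 hxy)]
  refine h2.trans ?_
  rw [Real.volume_real_Ioc_of_le hxy]
  refine mul_le_mul_of_nonneg_left ?_ (sub_nonneg.2 hxy)
  exact setIntegral_mono_set ((memLp_two_iff_integrable_sq_norm h.1.1).1 h.1)
    (Eventually.of_forall fun x => sq_nonneg _) hsub.eventuallyLE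

theorem HasDerivOnEdge.continuousOn (h : G.HasDerivOnEdge e f g) :
    ContinuousOn f (G.interval e) := by
  intro x hx
  rw [ContinuousWithinAt, tendsto_iff_norm_sub_tendsto_zero]
  have h1 : Tendsto (fun y => √(|y - x| * ∫ t in G.interval e, ‖g t‖ ^ 2))
      (𝓝[G.interval e] x) (𝓝 0) := by
    have : Continuous fun y : ℝ => √(|y - x| * ∫ t in G.interval e, ‖g t‖ ^ 2) := by fun_prop
    have h2 := this.tendsto x
    simp only [sub_self, abs_zero, zero_mul, Real.sqrt_zero] at h2
    exact h2.mono_left nhdsWithin_le_nhds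
  refine squeeze_zero' (Eventually.of_forall fun _ => norm_nonneg _) ?_ h1
  filter_upwards [self_mem_nhdsWithin] with y hy
  exact Real.le_sqrt_of_sq_le (h.norm_sub_sq_le hx hy)

theorem HasDerivOnEdge.aestronglyMeasurable (h : G.HasDerivOnEdge e f g) :
    AEStronglyMeasurable f (volume.restrict (G.interval e)) :=
  h.continuousOn.aestronglyMeasurable (G.measurableSet_interval e)

theorem HasDerivOnEdge.ae_hasDerivAt (h : G.HasDerivOnEdge e f g) :
    ∀ᵐ x ∂volume.restrict (G.interval e), HasDerivAt f (g x) x := by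
  have hloc : LocallyIntegrable ((G.interval e).indicator g) := by
    rw [MeasureTheory.locallyIntegrable_iff]
    intro K hK
    have : IsFiniteMeasure (volume.restrict K) := ⟨by simpa using hK.measure_lt_top⟩
    -- Extending `g` by zero gives a locally integrable function on the line, to which Lebesgue
    -- differentiation applies.
    have : MemLp ((G.interval e).indicator g) 2 volume :=
      (memLp_indicator_iff_restrict (G.measurableSet_interval e)).2 h.1
    exact (this.mono_measure Measure.restrict_le_self).integrable (by norm_num)
  filter_upwards [ae_restrict_of_ae (LocallyIntegrable.ae_hasDerivAt_integral hloc), G.ae_interval_mem_nhds e,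
    ae_restrict_mem (G.measurableSet_interval e)] with x hx hn hxI
  have h1 := (hx 0).const_add (f 0)
  rw [Set.indicator_of_mem hxI] at h1
  refine h1.congr_of_eventuallyEq ?_
  filter_upwards [hn] with y hy
  rw [h.2 y hy, intervalIntegral.integral_of_le hy.1, intervalIntegral.integral_of_le hy.1]
  congr 1
  refine setIntegral_congr_fun measurableSet_Ioc fun z hz => ?_
  rw [Set.indicator_of_mem (G.Icc_subset_interval (G.zero_mem_interval e) hy ⟨hz.1.le, hz.2⟩)]

/-- Averages the Hölder bound over a window of length `δ` that contains `y` and fits into the edge.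
The free parameter `δ` later makes the gradient term small. -/
theorem HasDerivOnEdge.mul_norm_sq_le (h : G.HasDerivOnEdge e f g) {δ y : ℝ} (hδ0 : 0 < δ)
    (hδ : δ ∈ G.interval e) (hy : y ∈ G.interval e) : ∃ c, Set.Ioc c (c + δ) ⊆ G.interval e ∧
    δ * ‖f y‖ ^ 2 ≤ 2 * (∫ t in Set.Ioc c (c + δ), ‖f t‖ ^ 2) +
      2 * δ ^ 2 * ∫ t in G.interval e, ‖g t‖ ^ 2 := by
  obtain ⟨c, hc, hc', hyc⟩ : ∃ c, c ∈ G.interval e ∧ c + δ ∈ G.interval e ∧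
      y ∈ Set.Icc c (c + δ) := by
    rcases le_total δ y with hle | hle
    · refine ⟨y - δ, ?_, by simpa using hy, by simp [hδ0.le]⟩
      exact G.Icc_subset_interval (G.zero_mem_interval e) hy ⟨by linarith, by linarith⟩
    · exact ⟨0, G.zero_mem_interval e, by simpa using hδ, hy.1, by linarith⟩
  have hsub' : Set.Icc c (c + δ) ⊆ G.interval e := G.Icc_subset_interval hc hc'
  have hsub : Set.Ioc c (c + δ) ⊆ G.interval e := Set.Ioc_subset_Icc_self.trans hsub'
  refine ⟨c, hsub, ?_⟩
  set D := ∫ t in G.interval e, ‖g t‖ ^ 2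
  have hD : 0 ≤ D := integral_nonneg fun _ => sq_nonneg _
  have hcont : ContinuousOn (fun t => 2 * ‖f t‖ ^ 2 + 2 * δ * D) (Set.Icc c (c + δ)) := by
    have := h.continuousOn.mono hsub'
    fun_prop
  have h1 : ∫ _t in Set.Ioc c (c + δ), ‖f y‖ ^ 2 ≤
      ∫ t in Set.Ioc c (c + δ), (2 * ‖f t‖ ^ 2 + 2 * δ * D) := by
    refine setIntegral_mono_on (integrableOn_const (by simp))
      (hcont.integrableOn_Icc.mono_set Set.Ioc_subset_Icc_self) measurableSet_Ioc
      fun t ht => ?_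
    have h2 := h.norm_sub_sq_le (hsub ht) hy
    have h3 : |y - t| ≤ δ := by
      rw [abs_le]
      constructor <;> linarith [hyc.1, hyc.2, ht.1, ht.2]
    have h4 : ‖f y‖ ≤ ‖f t‖ + ‖f y - f t‖ := by
      simpa using norm_add_le (f t) (f y - f t)
    nlinarith [mul_le_mul_of_nonneg_right h3 hD, norm_nonneg (f y), norm_nonneg (f t),
      norm_nonneg (f y - f t), sq_nonneg (‖f t‖ - ‖f y - f t‖)]
  have h5 : ContinuousOn (fun t => 2 * ‖f t‖ ^ 2) (Set.Icc c (c + δ)) := by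
    have := h.continuousOn.mono hsub'
    fun_prop
  rw [integral_add (h5.integrableOn_Icc.mono_set Set.Ioc_subset_Icc_self) (integrableOn_const (by simp)),
    integral_const_mul] at h1
  simp only [integral_const, smul_eq_mul, MeasurableSet.univ, measureReal_restrict_apply,
    Set.univ_inter, Real.volume_real_Ioc_of_le (show c ≤ c + δ by linarith),
    add_sub_cancel_left] at h1
  linarith

theorem HasDerivOnEdge.exists_bound (h : G.HasDerivOnEdge e f g)
    (hf : MemLp f 2 (volume.restrict (G.interval e))) :
    ∃ C, ∀ x ∈ G.interval e, ‖f x‖ ≤ C := by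
  obtain ⟨δ, hδ0, -, hδ⟩ := G.exists_pos_mem_interval e one_pos
  refine ⟨√(δ⁻¹ * (2 * (∫ t in G.interval e, ‖f t‖ ^ 2) +
      2 * δ ^ 2 * ∫ t in G.interval e, ‖g t‖ ^ 2)), fun x hx => ?_⟩
  obtain ⟨c, hsub, hc⟩ := h.mul_norm_sq_le hδ0 hδ hx
  refine Real.le_sqrt_of_sq_le ?_
  rw [le_inv_mul_iff₀ hδ0]
  have : ∫ t in Set.Ioc c (c + δ), ‖f t‖ ^ 2 ≤ ∫ t in G.interval e, ‖f t‖ ^ 2 :=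
    setIntegral_mono_set ((memLp_two_iff_integrable_sq_norm hf.1).1 hf)
      (Eventually.of_forall fun x => sq_nonneg _) hsub.eventuallyLE
  linarith

theorem HasDerivOnEdge.integrable_norm_rpow (h : G.HasDerivOnEdge e f g)
    (hf : MemLp f 2 (volume.restrict (G.interval e))) {q : ℝ} (hq : 2 ≤ q) :
    Integrable (fun x => ‖f x‖ ^ q) (volume.restrict (G.interval e)) := by
  obtain ⟨C, hC⟩ := h.exists_bound hf
  have h2 : Integrable (fun x => ‖f x‖ ^ 2) (volume.restrict (G.interval e)) :=
    (memLp_two_iff_integrable_sq_norm hf.1).1 hf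
  refine (h2.const_mul (C ^ (q - 2))).mono'
    ((Real.continuous_rpow_const (by linarith)).comp_aestronglyMeasurable hf.1.norm) ?_
  filter_upwards [ae_restrict_mem (G.measurableSet_interval e)] with x hx
  rw [Real.norm_of_nonneg (by positivity)]
  have h3 : ‖f x‖ ^ q = ‖f x‖ ^ (q - 2) * ‖f x‖ ^ 2 := by
    rcases (norm_nonneg (f x)).eq_or_lt with h0 | h0
    · rw [← h0, Real.zero_rpow (by linarith)]
      simp
    · rw [← Real.rpow_natCast _ 2, ← Real.rpow_add h0]
      norm_num
  rw [h3]
  exact mul_le_mul_of_nonneg_right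
    (Real.rpow_le_rpow (norm_nonneg _) (hC x hx) (by linarith)) (sq_nonneg _)

/-- The trace inequality behind the coercivity of the action. -/
theorem exists_trace_bound (G : MetricGraph V E) (e : E) {q : ℝ} (hq : 2 < q) {ε : ℝ} (hε : 0 < ε) :
    ∃ C, 0 ≤ C ∧ ∀ f g : ℝ → ℂ, G.HasDerivOnEdge e f g →
      Integrable (fun x => ‖f x‖ ^ q) (volume.restrict (G.interval e)) → ∀ y ∈ G.interval e,
      ‖f y‖ ^ 2 ≤ ε * ((∫ t in G.interval e, ‖g t‖ ^ 2) + ∫ t in G.interval e, ‖f t‖ ^ q) + C := by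
  -- After division by `δ`, the gradient coefficient is `2δ ≤ ε`; the choice `ε * δ / 2` below makes
  -- the coefficient of the `q`-th power equal to `ε`.
  obtain ⟨δ, hδ0, hδε, hδ⟩ := G.exists_pos_mem_interval e (half_pos hε)
  obtain ⟨C, hC0, hC⟩ := sq_le_mul_rpow_add hq (show 0 < ε * δ / 2 by positivity)
  refine ⟨2 * C, by positivity, fun f g h hf y hy => ?_⟩
  obtain ⟨c, hsub, hc⟩ := h.mul_norm_sq_le hδ0 hδ hy
  have hfs : IntegrableOn (fun x => ‖f x‖ ^ q) (Set.Ioc c (c + δ)) :=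
    IntegrableOn.mono_set hf hsub
  have h1 : ∫ t in Set.Ioc c (c + δ), ‖f t‖ ^ 2 ≤
      ∫ t in Set.Ioc c (c + δ), (ε * δ / 2 * ‖f t‖ ^ q + C) := by
    refine integral_mono_of_nonneg (Eventually.of_forall fun _ => sq_nonneg _)
      ((hfs.const_mul _).add (integrableOn_const (by simp))) (Eventually.of_forall fun t => hC _ (norm_nonneg _))
  rw [integral_add (hfs.const_mul _) (integrableOn_const (by simp)), integral_const_mul] at h1
  simp only [integral_const, smul_eq_mul, MeasurableSet.univ, measureReal_restrict_apply,
    Set.univ_inter, Real.volume_real_Ioc_of_le (show c ≤ c + δ by linarith),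
    add_sub_cancel_left] at h1
  have h2 : ∫ t in Set.Ioc c (c + δ), ‖f t‖ ^ q ≤ ∫ t in G.interval e, ‖f t‖ ^ q :=
    setIntegral_mono_set hf (Eventually.of_forall fun x => by positivity) hsub.eventuallyLE
  have hD : 0 ≤ ∫ t in G.interval e, ‖g t‖ ^ 2 := integral_nonneg fun _ => sq_nonneg _
  refine le_of_mul_le_mul_left ?_ hδ0
  have h3 := mul_le_mul_of_nonneg_left h2 (show 0 ≤ ε * δ by positivity)
  have h4 := mul_le_mul_of_nonneg_left hδε (show 0 ≤ 2 * δ * ∫ t in G.interval e, ‖g t‖ ^ 2 by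
    positivity)
  nlinarith

end MetricGraph

/-! ### The action as Dirichlet integral, boundary form and density; coercivity. -/

namespace MetricGraph

variable {V E : Type*} {G : MetricGraph V E}

theorem hasL2DerivOn_iff {e : E} {f g : ℝ → ℂ} : HasL2DerivOn (G.interval e) f g ↔
    MemLp f 2 (volume.restrict (G.interval e)) ∧ G.HasDerivOnEdge e f g := Iff.rfl

variable (G)

/-- The boundary values of a function at all ends of edges. -/
def trace (ψ : E → ℝ → ℂ) : G.EdgeEnd → ℂ :=
  Sum.elim (fun e => ψ e 0) (fun e => ψ e.1 (G.length e.1).toReal)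

/-- The restriction of a family of boundary values to the ends of edges at `v`. -/
def atVertex (β : G.EdgeEnd → ℂ) (v : V) : EuclideanSpace ℂ (G.J v) :=
  WithLp.toLp 2 fun a => β a.1

theorem atVertex_trace (ψ : E → ℝ → ℂ) (v : V) : G.atVertex (G.trace ψ) v = G.bdryVal ψ v := rfl

theorem trace_smul (c : ℂ) (ψ : E → ℝ → ℂ) : G.trace (fun e x => c * ψ e x) = c • G.trace ψ := by
  ext (a | a) <;> simp [trace]

theorem trace_add (ψ φ : E → ℝ → ℂ) :
    G.trace (fun e x => ψ e x + φ e x) = G.trace ψ + G.trace φ := by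
  ext (a | a) <;> simp [trace]

theorem continuous_atVertex (v : V) : Continuous fun β => G.atVertex β v := by
  unfold atVertex
  fun_prop

/-- The density of the action without derivatives. -/
def density (p ω t : ℝ) : ℝ := 1 / (p + 1) * t ^ (p + 1) + ω / 2 * t ^ 2

theorem continuous_density {p : ℝ} (hp : 1 < p) (ω : ℝ) : Continuous (density p ω) := by
  unfold density
  have : Continuous fun t : ℝ => t ^ (p + 1) := Real.continuous_rpow_const (by linarith)
  fun_prop

theorem density_zero {p : ℝ} (hp : 1 < p) (ω : ℝ) : density p ω 0 = 0 := by
  rw [density, Real.zero_rpow (by linarith)]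
  simp

theorem density_nonneg {p ω : ℝ} (hp : 1 < p) (hω : 0 ≤ ω) {t : ℝ} (ht : 0 ≤ t) :
    0 ≤ density p ω t := by
  unfold density
  positivity

/-- Convexity at the midpoint is all that the comparison of two almost minimizers needs; this is
where `ω ≥ 0` enters that comparison. -/
theorem density_half_add_le {p ω : ℝ} (hp : 1 < p) (hω : 0 ≤ ω) (z w : ℂ) :
    density p ω ‖(2⁻¹ : ℂ) * (z + w)‖ ≤ 2⁻¹ * (density p ω ‖z‖ + density p ω ‖w‖) := by
  have h1 : ‖(2⁻¹ : ℂ) * (z + w)‖ ≤ 2⁻¹ * ‖z‖ + 2⁻¹ * ‖w‖ := by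
    rw [norm_mul]
    have : ‖(2⁻¹ : ℂ)‖ = 2⁻¹ := by simp
    rw [this]
    linarith [norm_add_le z w]
  have h2 := (convexOn_rpow (show 1 ≤ p + 1 by linarith)).2 (norm_nonneg z) (norm_nonneg w)
    (show (0 : ℝ) ≤ 2⁻¹ by norm_num) (show (0 : ℝ) ≤ 2⁻¹ by norm_num) (by norm_num)
  simp only [smul_eq_mul] at h2
  have h3 := (Real.rpow_le_rpow (norm_nonneg _) h1 (show 0 ≤ p + 1 by linarith)).trans h2
  have h4 : ‖(2⁻¹ : ℂ) * (z + w)‖ ^ 2 ≤ 2⁻¹ * (‖z‖ ^ 2 + ‖w‖ ^ 2) := by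
    refine (pow_le_pow_left₀ (norm_nonneg _) h1 2).trans ?_
    nlinarith [sq_nonneg (‖z‖ - ‖w‖)]
  have h5 : 0 ≤ 1 / (p + 1) := by positivity
  unfold density
  nlinarith [mul_le_mul_of_nonneg_left h3 h5, mul_le_mul_of_nonneg_left h4 (half_pos two_pos).le,
    mul_le_mul_of_nonneg_left h4 (show 0 ≤ ω / 2 by positivity)]

variable {G} in
theorem integrable_density {p : ℝ} (hp : 1 < p) (ω : ℝ) {e : E} {f g : ℝ → ℂ}
    (h : HasL2DerivOn (G.interval e) f g) :
    Integrable (fun x => density p ω ‖f x‖) (volume.restrict (G.interval e)) := by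
  have h1 := (hasL2DerivOn_iff.1 h).2.integrable_norm_rpow h.1 (show 2 ≤ p + 1 by linarith)
  have h2 := (memLp_two_iff_integrable_sq_norm h.1.1).1 h.1
  exact (h1.const_mul _).add (h2.const_mul _)

variable [Fintype E] (A B : ∀ v : V, Matrix (G.J v) (G.J v) ℂ)

theorem add_mem_formDomain {ψ φ : E → ℝ → ℂ} (hψ : ψ ∈ G.formDomain B) (hφ : φ ∈ G.formDomain B) :
    (fun e x => ψ e x + φ e x) ∈ G.formDomain B := by
  refine ⟨fun e => ?_, fun v => ?_⟩
  · obtain ⟨g, hg⟩ := hψ.1 e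
    obtain ⟨h, hh⟩ := hφ.1 e
    exact ⟨_, G.hasL2DerivOn_add hg hh⟩
  · rw [bdryVal_add, map_add, hψ.2, hφ.2, add_zero]

theorem smul_mem_formDomain (c : ℂ) {ψ : E → ℝ → ℂ} (hψ : ψ ∈ G.formDomain B) :
    (fun e x => c * ψ e x) ∈ G.formDomain B := by
  refine ⟨fun e => ?_, fun v => ?_⟩
  · obtain ⟨g, hg⟩ := hψ.1 e
    exact ⟨_, hasL2DerivOn_smul c hg⟩
  · rw [bdryVal_smul, map_smul, hψ.2, smul_zero]

theorem zero_mem_formDomain : (fun _ _ => 0) ∈ G.formDomain B := by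
  refine ⟨fun e => ⟨_, hasL2DerivOn_zero _⟩, fun v => ?_⟩
  rw [bdryVal_zero, map_zero]

theorem lpPow_two (ψ : E → ℝ → ℂ) : G.lpPow 2 ψ = ∑ e, ∫ x in G.interval e, ‖ψ e x‖ ^ 2 := by
  simp [lpPow]

variable {G} in
theorem sum_integral_density {p : ℝ} (hp : 1 < p) (ω : ℝ) {ψ g : E → ℝ → ℂ}
    (h : ∀ e, HasL2DerivOn (G.interval e) (ψ e) (g e)) :
    ∑ e, ∫ x in G.interval e, density p ω ‖ψ e x‖ =
      1 / (p + 1) * G.lpPow (p + 1) ψ + ω / 2 * G.lpPow 2 ψ := by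
  rw [lpPow_two, lpPow, Finset.mul_sum, Finset.mul_sum, ← Finset.sum_add_distrib]
  refine Finset.sum_congr rfl fun e _ => ?_
  have h1 := (hasL2DerivOn_iff.1 (h e)).2.integrable_norm_rpow (h e).1 (show 2 ≤ p + 1 by linarith)
  have h2 := (memLp_two_iff_integrable_sq_norm (h e).1.1).1 (h e).1
  unfold density
  rw [integral_add (h1.const_mul _) (h2.const_mul _), integral_const_mul, integral_const_mul]

variable [Fintype V]

/-- The part of the quadratic form that lives at the vertices. -/
def bdryForm (β : G.EdgeEnd → ℂ) : ℝ :=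
  ∑ v, RCLike.re (inner ℂ (G.robin A B v (G.projR A B v (G.atVertex β v)))
    (G.projR A B v (G.atVertex β v)))

theorem continuous_bdryForm : Continuous (G.bdryForm A B) := by
  unfold bdryForm
  refine continuous_finsetSum _ fun v _ => ?_
  have h1 : Continuous fun β => G.projR A B v (G.atVertex β v) :=
    (G.projR A B v).continuous.comp (G.continuous_atVertex v)
  exact RCLike.continuous_re.comp
    (((G.robin A B v).continuous_of_finiteDimensional.comp h1).inner h1)

theorem bdryForm_smul (c : ℂ) (β : G.EdgeEnd → ℂ) :
    G.bdryForm A B (c • β) = ‖c‖ ^ 2 * G.bdryForm A B β := by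
  unfold bdryForm
  rw [Finset.mul_sum]
  refine Finset.sum_congr rfl fun v _ => ?_
  have : G.atVertex (c • β) v = c • G.atVertex β v := rfl
  rw [this, map_smul, map_smul, inner_smul_left, inner_smul_right, ← mul_assoc, Complex.conj_mul',
    ← Complex.ofReal_pow]
  exact RCLike.re_ofReal_mul _ _

/-- The boundary form is a quadratic form in finitely many numbers, hence bounded. It can be
negative, so this constant decides how small `ε` must be in the trace inequality. -/
theorem exists_bdryForm_bound : ∃ K, 0 ≤ K ∧ ∀ (β : G.EdgeEnd → ℂ) (M : ℝ), (∀ a, ‖β a‖ ^ 2 ≤ M) →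
    |G.bdryForm A B β| ≤ K * M := by
  have hv : ∀ v, ∃ K, 0 ≤ K ∧ ∀ (β : G.EdgeEnd → ℂ) (M : ℝ), (∀ a, ‖β a‖ ^ 2 ≤ M) →
      |RCLike.re (inner ℂ (G.robin A B v (G.projR A B v (G.atVertex β v)))
        (G.projR A B v (G.atVertex β v)))| ≤ K * M := by
    intro v
    set R := G.projR A B v
    set L := LinearMap.toContinuousLinearMap (G.robin A B v)
    refine ⟨‖L‖ * ‖R‖ ^ 2 * Fintype.card (G.J v), by positivity, fun β M hM => ?_⟩
    have h1 : ‖G.atVertex β v‖ ^ 2 ≤ Fintype.card (G.J v) * M := by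
      rw [EuclideanSpace.norm_sq_eq]
      refine (Finset.sum_le_sum fun a _ => hM a.1).trans ?_
      simp
    have h2 := (Complex.abs_re_le_norm _).trans
      (norm_inner_le_norm (𝕜 := ℂ) (L (R (G.atVertex β v))) (R (G.atVertex β v)))
    refine h2.trans ?_
    have h3 := R.le_opNorm (G.atVertex β v)
    calc ‖L (R (G.atVertex β v))‖ * ‖R (G.atVertex β v)‖
        ≤ ‖L‖ * ‖R (G.atVertex β v)‖ * ‖R (G.atVertex β v)‖ := by
          gcongr
          exact L.le_opNorm _
      _ ≤ ‖L‖ * (‖R‖ * ‖G.atVertex β v‖) * (‖R‖ * ‖G.atVertex β v‖) := by gcongr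
      _ = ‖L‖ * ‖R‖ ^ 2 * ‖G.atVertex β v‖ ^ 2 := by ring
      _ ≤ ‖L‖ * ‖R‖ ^ 2 * (Fintype.card (G.J v) * M) := by gcongr
      _ = _ := by ring
  choose K hK0 hK using hv
  refine ⟨∑ v, K v, Finset.sum_nonneg fun v _ => hK0 v, fun β M hM => ?_⟩
  rw [Finset.sum_mul]
  exact (Finset.abs_sum_le_sum_abs _ _).trans (Finset.sum_le_sum fun v _ => hK v β M hM)

/-- The action of a function `ψ` with derivative `g`. -/
def pairAction (p ω : ℝ) (ψ g : E → ℝ → ℂ) : ℝ :=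
  1 / 2 * ∑ e, (∫ x in G.interval e, ‖g e x‖ ^ 2) + 1 / 2 * G.bdryForm A B (G.trace ψ) +
    ∑ e, ∫ x in G.interval e, density p ω ‖ψ e x‖

variable {G}

theorem form_eq {ψ g : E → ℝ → ℂ} (h : ∀ e, HasL2DerivOn (G.interval e) (ψ e) (g e)) :
    G.form A B ψ = ∑ e, (∫ x in G.interval e, ‖g e x‖ ^ 2) + G.bdryForm A B (G.trace ψ) := by
  rw [form, lpPow_two]
  congr 1
  refine Finset.sum_congr rfl fun e _ => integral_congr_ae ?_
  filter_upwards [(hasL2DerivOn_iff.1 (h e)).2.ae_hasDerivAt] with x hx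
  rw [hx.deriv]

theorem action_eq_pairAction {p : ℝ} (hp : 1 < p) (ω : ℝ) {ψ g : E → ℝ → ℂ}
    (h : ∀ e, HasL2DerivOn (G.interval e) (ψ e) (g e)) :
    G.action A B p ω ψ = G.pairAction A B p ω ψ g := by
  rw [action, energy, mass, pairAction, sum_integral_density hp ω h, form_eq A B h]
  ring

theorem action_zero {p : ℝ} (hp : 1 < p) (ω : ℝ) : G.action A B p ω (fun _ _ => 0) = 0 := by
  rw [action_eq_pairAction A B hp ω (g := fun _ _ => 0) fun e => hasL2DerivOn_zero _, pairAction]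
  -- Written as a zero multiple, the trace is annihilated through the homogeneity `bdryForm_smul`.
  have : G.trace (fun _ _ => 0) = (0 : ℂ) • G.trace (fun _ _ => 0) := by
    rw [← trace_smul]
    simp
  rw [this, bdryForm_smul]
  simp [density_zero hp]

/-- The action controls the Dirichlet integral, the `L^{p+1}` norm and the boundary values. -/
theorem exists_coercive {p : ℝ} (hp : 1 < p) : ∃ κ C₁ C₂ : ℝ, 0 < κ ∧ 0 ≤ C₂ ∧ ∀ (ω : ℝ),
    0 ≤ ω → ∀ ψ g : E → ℝ → ℂ, (∀ e, HasL2DerivOn (G.interval e) (ψ e) (g e)) →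
    κ * (∑ e, ∫ x in G.interval e, ‖g e x‖ ^ 2) ≤ G.pairAction A B p ω ψ g + C₁ ∧
    (∀ a, ‖G.trace ψ a‖ ^ 2 ≤ C₂ * (G.pairAction A B p ω ψ g + C₁) + C₂) := by
  obtain ⟨K, hK0, hK⟩ := G.exists_bdryForm_bound A B
  -- Half the coefficient of the `L^{p+1}` term. With `ε = κ / (K + 1)` the boundary form, which
  -- enters with factor `1/2`, costs at most `κ/2` times the Dirichlet and `L^{p+1}` terms, plus a
  -- constant.
  set κ : ℝ := 1 / (2 * (p + 1)) with hκ
  have hκ0 : 0 < κ := by positivity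
  have hκ1 : κ ≤ 1 / 4 := by
    rw [hκ]
    apply one_div_le_one_div_of_le <;> linarith
  set ε : ℝ := κ / (K + 1) with hε
  have hε0 : 0 < ε := by positivity
  choose C hC0 hC using fun e => exists_trace_bound G e (show 2 < p + 1 by linarith) hε0
  set D := ∑ e, C e
  have hD0 : 0 ≤ D := Finset.sum_nonneg fun e _ => hC0 e
  refine ⟨κ, K * D, max (ε / κ) D, hκ0, by positivity, fun ω hω ψ g h => ?_⟩
  set X := ∑ e, ∫ x in G.interval e, ‖g e x‖ ^ 2 with hX
  set Y := G.lpPow (p + 1) ψ with hY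
  have hX' : ∀ e, 0 ≤ ∫ x in G.interval e, ‖g e x‖ ^ 2 := fun e =>
    integral_nonneg fun _ => sq_nonneg _
  have hY' : ∀ e, 0 ≤ ∫ x in G.interval e, ‖ψ e x‖ ^ (p + 1) := fun e =>
    integral_nonneg fun _ => Real.rpow_nonneg (norm_nonneg _) _
  have hX0 : 0 ≤ X := Finset.sum_nonneg fun e _ => hX' e
  have hY0 : 0 ≤ Y := Finset.sum_nonneg fun e _ => hY' e
  have hM0 : 0 ≤ G.lpPow 2 ψ := by
    rw [lpPow_two]
    exact Finset.sum_nonneg fun e _ => integral_nonneg fun _ => sq_nonneg _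
  have hpt : ∀ e, ∀ y ∈ G.interval e, ‖ψ e y‖ ^ 2 ≤ ε * (X + Y) + D := by
    intro e y hy
    have h1 := hC e (ψ e) (g e) (h e).2 ((hasL2DerivOn_iff.1 (h e)).2.integrable_norm_rpow (h e).1
      (by linarith)) y hy
    have h2 : ∫ x in G.interval e, ‖g e x‖ ^ 2 ≤ X :=
      Finset.single_le_sum (f := fun e => ∫ x in G.interval e, ‖g e x‖ ^ 2) (fun e _ => hX' e)
        (Finset.mem_univ e)
    have h3 : ∫ x in G.interval e, ‖ψ e x‖ ^ (p + 1) ≤ Y :=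
      Finset.single_le_sum (f := fun e => ∫ x in G.interval e, ‖ψ e x‖ ^ (p + 1))
        (fun e _ => hY' e) (Finset.mem_univ e)
    have h4 : C e ≤ D := Finset.single_le_sum (f := C) (fun e _ => hC0 e) (Finset.mem_univ e)
    nlinarith
  have htr : ∀ a, ‖G.trace ψ a‖ ^ 2 ≤ ε * (X + Y) + D := by
    rintro (e | e)
    · exact hpt e 0 (G.zero_mem_interval e)
    · exact hpt e.1 _ (G.length_mem_interval e.2)
  have hb := (abs_le.1 (hK _ _ htr)).1
  have hKε : K * ε ≤ κ := by
    rw [hε, mul_div_assoc', div_le_iff₀ (by linarith)]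
    nlinarith
  have hmain : κ * (X + Y) ≤ G.pairAction A B p ω ψ g + K * D := by
    rw [pairAction, sum_integral_density hp ω h]
    have h1 : 1 / (p + 1) = 2 * κ := by
      rw [hκ]
      field_simp
    rw [h1, ← hX, ← hY]
    nlinarith [mul_le_mul_of_nonneg_right hKε (add_nonneg hX0 hY0), mul_nonneg hω hM0,
      mul_nonneg hK0 hD0, mul_le_mul_of_nonneg_right hκ1 hX0, mul_le_mul_of_nonneg_right hκ1 hY0,
      mul_nonneg hκ0.le hX0, mul_nonneg hκ0.le hY0]
  refine ⟨by nlinarith, fun a => (htr a).trans ?_⟩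
  have h0 : 0 ≤ G.pairAction A B p ω ψ g + K * D := le_trans (by positivity) hmain
  have h1 : ε * (X + Y) = ε / κ * (κ * (X + Y)) := by field_simp
  rw [h1]
  refine add_le_add ?_ (le_max_right _ _)
  exact mul_le_mul (le_max_left _ _) hmain (by positivity) (by positivity)

/-- Almost minimizers with nearby boundary values have nearby derivatives. -/
theorem sum_integral_norm_sub_sq_le {p ω m : ℝ} (hp : 1 < p) (hω : 0 ≤ ω)
    (hm : ∀ φ ∈ G.formDomain B, m ≤ G.action A B p ω φ) {ψ g φ h : E → ℝ → ℂ}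
    (hψ : ψ ∈ G.formDomain B) (hφ : φ ∈ G.formDomain B)
    (hg : ∀ e, HasL2DerivOn (G.interval e) (ψ e) (g e))
    (hh : ∀ e, HasL2DerivOn (G.interval e) (φ e) (h e)) :
    ∑ e, ∫ x in G.interval e, ‖g e x - h e x‖ ^ 2 ≤
      4 * (G.pairAction A B p ω ψ g - m) + 4 * (G.pairAction A B p ω φ h - m) +
      (4 * G.bdryForm A B ((2⁻¹ : ℂ) • (G.trace ψ + G.trace φ)) -
        2 * G.bdryForm A B (G.trace ψ) - 2 * G.bdryForm A B (G.trace φ)) := by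
  -- The form domain is linear, so the midpoint competes with `m` as well.
  have hmid := hm _ (G.smul_mem_formDomain B 2⁻¹ (G.add_mem_formDomain B hψ hφ))
  have hd := fun e => hasL2DerivOn_smul 2⁻¹ (G.hasL2DerivOn_add (hg e) (hh e))
  rw [action_eq_pairAction A B hp ω hd] at hmid
  simp only [pairAction] at hmid ⊢
  rw [trace_smul, trace_add] at hmid
  have hdens : ∑ e, ∫ x in G.interval e, density p ω ‖(2⁻¹ : ℂ) * (ψ e x + φ e x)‖ ≤
      2⁻¹ * (∑ e, (∫ x in G.interval e, density p ω ‖ψ e x‖) +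
        ∑ e, ∫ x in G.interval e, density p ω ‖φ e x‖) := by
    rw [← Finset.sum_add_distrib, Finset.mul_sum]
    refine Finset.sum_le_sum fun e _ => ?_
    have h1 := integrable_density hp ω (hg e)
    have h2 := integrable_density hp ω (hh e)
    rw [← integral_add h1 h2, ← integral_const_mul]
    exact integral_mono (integrable_density hp ω (hd e)) ((h1.add h2).const_mul _)
      fun x => density_half_add_le hp hω _ _
  -- The parallelogram law: the defect of convexity of the Dirichlet integral is exactly the squared
  -- distance of the derivatives.
  have hgrad : ∑ e, ∫ x in G.interval e, ‖(2⁻¹ : ℂ) * (g e x + h e x)‖ ^ 2 =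
      2⁻¹ * (∑ e, (∫ x in G.interval e, ‖g e x‖ ^ 2) + ∑ e, ∫ x in G.interval e, ‖h e x‖ ^ 2) -
        4⁻¹ * ∑ e, ∫ x in G.interval e, ‖g e x - h e x‖ ^ 2 := by
    rw [← Finset.sum_add_distrib, Finset.mul_sum, Finset.mul_sum, ← Finset.sum_sub_distrib]
    refine Finset.sum_congr rfl fun e _ => ?_
    have h1 := (memLp_two_iff_integrable_sq_norm (hg e).2.1.1).1 (hg e).2.1
    have h2 := (memLp_two_iff_integrable_sq_norm (hh e).2.1.1).1 (hh e).2.1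
    have h3 := (memLp_two_iff_integrable_sq_norm ((hg e).2.1.sub (hh e).2.1).1).1
      ((hg e).2.1.sub (hh e).2.1)
    rw [← integral_add h1 h2, ← integral_const_mul, ← integral_const_mul]
    refine Eq.trans ?_ (integral_sub ((h1.add h2).const_mul 2⁻¹) (h3.const_mul 4⁻¹))
    refine integral_congr_ae (Eventually.of_forall fun x => ?_)
    have := parallelogram_law_with_norm ℝ (g e x) (h e x)
    have h5 : ‖(2⁻¹ : ℂ)‖ = 2⁻¹ := by simp
    simp only [norm_mul, h5]
    nlinarith
  linarith

end MetricGraph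

/-! ### Convergence of minimizing sequences to a relaxed minimizer. -/

namespace MetricGraph

variable {V E : Type*} {G : MetricGraph V E}

/-- The Hölder bound, applied to the primitive of `g n - h`, turns `L²` convergence of derivatives
into pointwise convergence of primitives. -/
theorem tendsto_integral_of_tendsto_toLp {e : E} {g : ℕ → ℝ → ℂ} {h : ℝ → ℂ}
    (hg : ∀ n, MemLp (g n) 2 (volume.restrict (G.interval e)))
    (hh : MemLp h 2 (volume.restrict (G.interval e)))
    (hlim : Tendsto (fun n => (hg n).toLp (g n)) atTop (𝓝 (hh.toLp h))) {x : ℝ}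
    (hx : x ∈ G.interval e) :
    Tendsto (fun n => ∫ t in (0 : ℝ)..x, g n t) atTop (𝓝 (∫ t in (0 : ℝ)..x, h t)) := by
  rw [tendsto_iff_norm_sub_tendsto_zero] at hlim ⊢
  have h1 : Tendsto (fun n => √(|x - 0| * ‖(hg n).toLp (g n) - hh.toLp h‖ ^ 2)) atTop (𝓝 0) := by
    have := ((hlim.pow 2).const_mul |x - 0|).sqrt
    simpa using this
  refine squeeze_zero (fun _ => norm_nonneg _) (fun n => Real.le_sqrt_of_sq_le ?_) h1
  have hd : G.HasDerivOnEdge e (fun x => ∫ t in (0 : ℝ)..x, (g n t - h t)) (fun t => g n t - h t) :=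
    ⟨(hg n).sub hh, fun x _ => by simp⟩
  have h2 := hd.norm_sub_sq_le (G.zero_mem_interval e) hx
  rw [← MemLp.toLp_sub, norm_toLp_two_sq]
  simp only [intervalIntegral.integral_same, sub_zero] at h2
  rw [intervalIntegral.integral_sub (G.intervalIntegrable_of_memLp (hg n) hx)
    (G.intervalIntegrable_of_memLp hh hx)] at h2
  simpa using h2

variable [Fintype E] [Fintype V] (A B : ∀ v : V, Matrix (G.J v) (G.J v) ℂ)

/-- The action has a minimizer in the class of functions that are not necessarily square
integrable. -/
theorem exists_relaxed_minimizer {p ω : ℝ} (hp : 1 < p) (hω : 0 ≤ ω) : ∃ ψ g : E → ℝ → ℂ,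
    (∀ e, G.HasDerivOnEdge e (ψ e) (g e)) ∧ (∀ v, G.projD B v (G.bdryVal ψ v) = 0) ∧
    (∀ e, Integrable (fun x => density p ω ‖ψ e x‖) (volume.restrict (G.interval e))) ∧
    ∀ φ ∈ G.formDomain B, G.pairAction A B p ω ψ g ≤ G.action A B p ω φ := by
  obtain ⟨κ, C₁, C₂, hκ, hC₂, hco⟩ := exists_coercive A B hp
  obtain ⟨K, hK0, hK⟩ := G.exists_bdryForm_bound A B
  have hX0 : ∀ g : E → ℝ → ℂ, 0 ≤ ∑ e, ∫ x in G.interval e, ‖g e x‖ ^ 2 := fun g =>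
    Finset.sum_nonneg fun e _ => integral_nonneg fun _ => sq_nonneg _
  have hbdd : BddBelow (G.action A B p ω '' G.formDomain B) := by
    refine ⟨-C₁, ?_⟩
    rintro _ ⟨φ, hφ, rfl⟩
    choose h hh using hφ.1
    rw [action_eq_pairAction A B hp ω hh]
    have h1 := (hco ω hω φ h hh).1
    have h2 := mul_nonneg hκ.le (hX0 h)
    linarith
  have hne : (G.action A B p ω '' G.formDomain B).Nonempty :=
    ⟨_, _, G.zero_mem_formDomain B, rfl⟩
  -- The sequence of values is antitone, so `u 0` bounds all of them.
  obtain ⟨u, hu_anti, hu_lim, hu_mem⟩ := exists_seq_tendsto_sInf hne hbdd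
  set m := sInf (G.action A B p ω '' G.formDomain B)
  have hm : ∀ φ ∈ G.formDomain B, m ≤ G.action A B p ω φ := fun φ hφ => csInf_le hbdd ⟨φ, hφ, rfl⟩
  choose Ψ hΨ hΨu using hu_mem
  choose g hg using fun n => (hΨ n).1
  have hs : ∀ n, G.pairAction A B p ω (Ψ n) (g n) = u n := fun n => by
    rw [← action_eq_pairAction A B hp ω (hg n), hΨu]
  set M := C₂ * (u 0 + C₁) + C₂
  have htr : ∀ n a, ‖G.trace (Ψ n) a‖ ^ 2 ≤ M := fun n a => by
    refine ((hco ω hω (Ψ n) (g n) (hg n)).2 a).trans ?_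
    rw [hs n]
    have := mul_le_mul_of_nonneg_left (hu_anti (Nat.zero_le n)) hC₂
    simp only [M]
    linarith
  set τ : ℕ → E → ℝ := fun n e => ∫ x in G.interval e, density p ω ‖Ψ n e x‖
  have hτ0 : ∀ n e, 0 ≤ τ n e := fun n e =>
    integral_nonneg fun x => density_nonneg hp hω (norm_nonneg _)
  have hτ : ∀ n e, τ n e ≤ u 0 + K * M := fun n e => by
    have h1 : τ n e ≤ ∑ e, τ n e :=
      Finset.single_le_sum (f := τ n) (fun e _ => hτ0 n e) (Finset.mem_univ e)
    have h2 := hs n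
    rw [pairAction] at h2
    have h3 := abs_le.1 (hK _ _ (htr n))
    have h4 := hX0 (g n)
    have h5 := hu_anti (Nat.zero_le n)
    have h6 := (abs_nonneg _).trans (hK _ _ (htr n))
    linarith
  have := Fintype.ofFinite G.EdgeEnd
  -- One compactness argument in a finite-dimensional space makes the boundary values and the
  -- density integrals of all edges converge together.
  obtain ⟨⟨β, T⟩, -, k, hk, hlim⟩ := tendsto_subseq_of_bounded
    (Metric.isBounded_closedBall (x := (0 : (G.EdgeEnd → ℂ) × (E → ℝ)))
      (r := max √M (u 0 + K * M))) (x := fun n => (G.trace (Ψ n), τ n)) (fun n => by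
      rw [mem_closedBall_zero_iff, Prod.norm_def]
      refine max_le_max ?_ ?_
      · exact (pi_norm_le_iff_of_nonneg (Real.sqrt_nonneg _)).2 fun a =>
          Real.le_sqrt_of_sq_le (htr n a)
      · refine (pi_norm_le_iff_of_nonneg ?_).2 fun e => ?_
        · have h6 := (abs_nonneg _).trans (hK _ _ (htr 0))
          have h7 := hs 0
          rw [pairAction] at h7
          have h3 := abs_le.1 (hK _ _ (htr 0))
          have h8 := Finset.sum_nonneg fun e (_ : e ∈ Finset.univ) => hτ0 0 e
          have h4 := hX0 (g 0)
          simp only [τ] at h8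
          linarith
        · rw [Real.norm_of_nonneg (hτ0 n e)]
          exact hτ n e)
  rw [Prod.tendsto_iff] at hlim
  obtain ⟨hβ, hT⟩ := hlim
  simp only [Function.comp_def] at hβ hT
  have hu : Tendsto (fun n => u (k n)) atTop (𝓝 m) := hu_lim.comp hk.tendsto_atTop
  set U : ∀ e, ℕ → Lp ℂ 2 (volume.restrict (G.interval e)) :=
    fun e n => (hg (k n) e).2.1.toLp (g (k n) e)
  have hbc := G.continuous_bdryForm A B
  have hcauchy : ∀ e, CauchySeq (U e) := by
    intro e
    rw [cauchySeq_iff_tendsto_dist_atTop_0]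
    have hf : Tendsto (fun n : ℕ × ℕ => n.1) atTop atTop :=
      prod_atTop_atTop_eq (α := ℕ) (β := ℕ) ▸ tendsto_fst
    have hs' : Tendsto (fun n : ℕ × ℕ => n.2) atTop atTop :=
      prod_atTop_atTop_eq (α := ℕ) (β := ℕ) ▸ tendsto_snd
    -- The energy gaps vanish by minimality; the boundary terms cancel in the limit because both
    -- traces and their midpoint tend to `β`, and `4 - 2 - 2 = 0`.
    have hr : Tendsto (fun n : ℕ × ℕ => 4 * (u (k n.1) - m) + 4 * (u (k n.2) - m) +
        (4 * G.bdryForm A B ((2⁻¹ : ℂ) • (G.trace (Ψ (k n.1)) + G.trace (Ψ (k n.2)))) -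
        2 * G.bdryForm A B (G.trace (Ψ (k n.1))) - 2 * G.bdryForm A B (G.trace (Ψ (k n.2)))))
        atTop (𝓝 0) := by
      have h1 := hu.comp hf
      have h2 := hu.comp hs'
      have h3 := hβ.comp hf
      have h4 := hβ.comp hs'
      have h5 := (hbc.tendsto _).comp ((h3.add h4).const_smul (2⁻¹ : ℂ))
      have h6 := (((h1.sub_const m).const_mul 4).add ((h2.sub_const m).const_mul 4)).add
        (((h5.const_mul 4).sub (((hbc.tendsto _).comp h3).const_mul 2)).sub
          (((hbc.tendsto _).comp h4).const_mul 2))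
      have h7 : (2⁻¹ : ℂ) • (β + β) = β := by
        rw [← two_smul ℂ β, smul_smul]
        norm_num
      have h8 : 4 * (m - m) + 4 * (m - m) + (4 * G.bdryForm A B β - 2 * G.bdryForm A B β -
          2 * G.bdryForm A B β) = 0 := by ring
      rw [h7, h8] at h6
      exact h6
    have hr' := hr.sqrt
    rw [Real.sqrt_zero] at hr'
    refine squeeze_zero (fun _ => dist_nonneg) (fun n => Real.le_sqrt_of_sq_le ?_) hr'
    have h1 := sum_integral_norm_sub_sq_le A B hp hω hm (hΨ (k n.1)) (hΨ (k n.2)) (hg (k n.1))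
      (hg (k n.2))
    rw [hs, hs] at h1
    refine le_trans ?_ h1
    rw [dist_eq_norm, ← MemLp.toLp_sub, norm_toLp_two_sq]
    exact Finset.single_le_sum
      (f := fun e => ∫ x in G.interval e, ‖g (k n.1) e x - g (k n.2) e x‖ ^ 2)
      (fun e _ => integral_nonneg fun _ => sq_nonneg _) (Finset.mem_univ e)
  choose Γ hΓ using fun e => cauchySeq_tendsto_of_complete (hcauchy e)
  set γ : E → ℝ → ℂ := fun e => Γ e with hγ
  have hγ2 : ∀ e, MemLp (γ e) 2 (volume.restrict (G.interval e)) := fun e => Lp.memLp (Γ e)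
  have hγΓ : ∀ e, (hγ2 e).toLp (γ e) = Γ e := fun e => Lp.toLp_coeFn _ _
  -- The limit is rebuilt from the limiting value at the initial end and the limiting derivative.
  -- That its terminal values also agree with `β` follows from pointwise convergence.
  set ψ : E → ℝ → ℂ := fun e x => β (Sum.inl e) + ∫ t in (0 : ℝ)..x, γ e t with hψ
  have hder : ∀ e, G.HasDerivOnEdge e (ψ e) (γ e) := fun e => ⟨hγ2 e, fun x _ => by simp [hψ]⟩
  have hpt : ∀ e, ∀ x ∈ G.interval e,
      Tendsto (fun n => Ψ (k n) e x) atTop (𝓝 (ψ e x)) := by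
    intro e x hx
    have h1 : Tendsto (fun n => Ψ (k n) e 0) atTop (𝓝 (β (Sum.inl e))) :=
      (tendsto_pi_nhds.1 hβ) (Sum.inl e)
    have h2 := tendsto_integral_of_tendsto_toLp (fun n => (hg (k n) e).2.1) (hγ2 e)
      (by rw [hγΓ]; exact hΓ e) hx
    refine (h1.add h2).congr fun n => ?_
    exact ((hg (k n) e).2.2 x hx).symm
  have htrace : G.trace ψ = β := by
    ext (e | e)
    · simp [trace, hψ]
    · exact tendsto_nhds_unique (hpt e.1 _ (G.length_mem_interval e.2))
        ((tendsto_pi_nhds.1 hβ) (Sum.inr e))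
  have hfatou := fun e => integrable_and_integral_le_of_tendsto
    (F := fun n x => density p ω ‖Ψ (k n) e x‖) (f := fun x => density p ω ‖ψ e x‖)
    (fun n => integrable_density hp ω (hg (k n) e))
    (fun n x => density_nonneg hp hω (norm_nonneg _))
    (by
      filter_upwards [ae_restrict_mem (G.measurableSet_interval e)] with x hx
      exact ((continuous_density hp ω).tendsto _).comp (hpt e x hx).norm)
    ((tendsto_pi_nhds.1 hT) e)
  refine ⟨ψ, γ, hder, fun v => ?_, fun e => (hfatou e).1, fun φ hφ => le_trans ?_ (hm φ hφ)⟩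
  · rw [← atVertex_trace, htrace]
    have h1 := ((G.projD B v).continuous.tendsto _).comp
      (((G.continuous_atVertex v).tendsto _).comp hβ)
    refine tendsto_nhds_unique h1 (tendsto_const_nhds.congr fun n => ?_)
    exact ((hΨ (k n)).2 v).symm
  · have hX : Tendsto (fun n => ∑ e, ∫ x in G.interval e, ‖g (k n) e x‖ ^ 2) atTop
        (𝓝 (∑ e, ∫ x in G.interval e, ‖γ e x‖ ^ 2)) := by
      refine tendsto_finsetSum _ fun e _ => ?_
      rw [← norm_toLp_two_sq (hγ2 e), hγΓ]
      refine ((hΓ e).norm.pow 2).congr fun n => ?_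
      exact norm_toLp_two_sq _
    have hsum : Tendsto (fun n => ∑ e, τ (k n) e) atTop (𝓝 (∑ e, T e)) :=
      tendsto_finsetSum _ fun e _ => (tendsto_pi_nhds.1 hT) e
    -- The Dirichlet and boundary parts pass to the limit exactly, so only the density can drop, and
    -- it drops in the right direction.
    have hall := ((hX.const_mul (1 / 2)).add
      (((hbc.tendsto _).comp hβ).const_mul (1 / 2))).add hsum
    have hmeq := tendsto_nhds_unique hu (hall.congr fun n => hs (k n))
    rw [hmeq, pairAction, htrace]
    gcongr with e
    exact (hfatou e).2

end MetricGraph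

/-! ### The half-line problem at zero frequency. -/

theorem hasL2DerivOn_Ici_of_hasDerivAt {f g : ℝ → ℂ} (hfg : ∀ x, 0 ≤ x → HasDerivAt f (g x) x)
    (hg : ContinuousOn g (Set.Ici 0)) (hf2 : IntegrableOn (fun x => ‖f x‖ ^ 2) (Set.Ioi 0))
    (hg2 : IntegrableOn (fun x => ‖g x‖ ^ 2) (Set.Ioi 0)) :
    HasL2DerivOn (Set.Ici 0) f g := by
  have hf : ContinuousOn f (Set.Ici 0) := fun x hx => (hfg x hx).continuousAt.continuousWithinAt
  refine ⟨(memLp_two_iff_integrable_sq_norm (hf.aestronglyMeasurable measurableSet_Ici)).2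
    ((integrableOn_Ici_iff_integrableOn_Ioi (by simp)).2 hf2),
    (memLp_two_iff_integrable_sq_norm (hg.aestronglyMeasurable measurableSet_Ici)).2
    ((integrableOn_Ici_iff_integrableOn_Ioi (by simp)).2 hg2), fun x hx => ?_⟩
  rw [intervalIntegral.integral_eq_sub_of_hasDerivAt (f := f)]
  · ring
  · intro y hy
    rw [Set.uIcc_of_le hx] at hy
    exact hfg y hy.1
  · refine (hg.mono ?_).intervalIntegrable
    rw [Set.uIcc_of_le hx]
    exact Set.Icc_subset_Ici_self

theorem integrableOn_one_add_mul_rpow {c a : ℝ} (hc : 0 < c) (ha : a < -1) :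
    IntegrableOn (fun x : ℝ => (1 + c * x) ^ a) (Set.Ioi 0) := by
  have h := (integrableOn_add_rpow_Ioi_of_lt ha (m := c⁻¹) (c := 0)
    (by simpa using hc)).const_mul (c ^ a)
  refine IntegrableOn.congr_fun h (fun x hx => ?_) measurableSet_Ioi
  have hx : 0 < x := hx
  rw [← Real.mul_rpow hc.le (by positivity)]
  congr 1
  field_simp
  ring

/-- The convex function `s^{p+1}/(p+1)` lies above its tangent at `w`; this is Young's inequality
for `s` and `w^p`. -/
theorem mul_rpow_sub_le {p s w : ℝ} (hp : 1 < p) (hs : 0 ≤ s) (hw : 0 ≤ w) :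
    1 / (p + 1) * w ^ (p + 1) + w ^ p * (s - w) ≤ 1 / (p + 1) * s ^ (p + 1) := by
  have hconj : (p + 1).HolderConjugate ((p + 1) / p) := by
    rw [Real.holderConjugate_iff]
    refine ⟨by linarith, ?_⟩
    field_simp
    ring
  have h1 := Real.young_inequality_of_nonneg hs (Real.rpow_nonneg hw p) hconj
  have h2 : (w ^ p) ^ ((p + 1) / p) = w ^ (p + 1) := by
    rw [← Real.rpow_mul hw]
    congr 1
    field_simp
  have h3 : w ^ (p + 1) = w ^ p * w := Real.rpow_add_one' hw (by linarith)
  rw [h2] at h1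
  have h4 : w ^ (p + 1) / ((p + 1) / p) = w ^ (p + 1) - 1 / (p + 1) * w ^ (p + 1) := by
    field_simp
    ring
  rw [h4, div_eq_inv_mul, ← one_div] at h1
  nlinarith

/-- Integration by parts when `η` is only integrable: its primitive is absolutely continuous, and
`w` is Lipschitz on the compact interval. -/
theorem integral_mul_add_mul_primitive {w w' η : ℝ → ℝ} {R : ℝ} (hR : 0 ≤ R)
    (hw : ∀ x ∈ Set.Icc 0 R, HasDerivAt w (w' x) x) (hw' : ContinuousOn w' (Set.Icc 0 R))
    (hη : IntervalIntegrable η volume 0 R) :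
    ∫ x in (0 : ℝ)..R, (w x * η x + w' x * ∫ t in (0 : ℝ)..x, η t) =
      w R * ∫ t in (0 : ℝ)..R, η t := by
  have hac := hη.absolutelyContinuousOnInterval_intervalIntegral (c := 0) (by simp)
  have hacw : AbsolutelyContinuousOnInterval w 0 R := by
    obtain ⟨K, hK⟩ := isCompact_Icc.exists_bound_of_continuousOn hw'
    have hlip : LipschitzOnWith K.toNNReal w (Set.Icc 0 R) :=
      (convex_Icc 0 R).lipschitzOnWith_of_nnnorm_hasDerivWithin_le
        (fun x hx => (hw x hx).hasDerivWithinAt) fun x hx => by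
          rw [← NNReal.coe_le_coe, coe_nnnorm]
          exact (hK x hx).trans (Real.le_coe_toNNReal K)
    rw [← Set.uIcc_of_le hR] at hlip
    exact hlip.absolutelyContinuousOnInterval
  have h := hacw.integral_deriv_mul_eq_sub hac
  rw [intervalIntegral.integral_same, mul_zero, sub_zero] at h
  rw [← h]
  refine intervalIntegral.integral_congr_ae ?_
  filter_upwards [hη.ae_hasDerivAt_integral] with x hx hxI
  have hxI' := Set.uIoc_subset_uIcc hxI
  rw [(hx hxI' 0 (by simp)).deriv]
  rw [Set.uIcc_of_le hR] at hxI'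
  rw [(hw x hxI').deriv]
  ring

/-- The half-line problem with given initial value and vanishing frequency: some square integrable
profile does at least as well as any given function. -/
theorem MetricGraph.HasDerivOnEdge.exists_profile {V E : Type*} {G : MetricGraph V E} {e : E}
    {f g : ℝ → ℂ} (h : G.HasDerivOnEdge e f g) (he : G.length e = ⊤) {p : ℝ} (hp : 1 < p)
    (hp5 : p < 5)
    (hf : Integrable (fun x => density p 0 ‖f x‖) (volume.restrict (G.interval e))) :
    ∃ u u' : ℝ → ℂ, HasL2DerivOn (G.interval e) u u' ∧ u 0 = f 0 ∧
      1 / 2 * (∫ x in G.interval e, ‖u' x‖ ^ 2) + ∫ x in G.interval e, density p 0 ‖u x‖ ≤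
      1 / 2 * (∫ x in G.interval e, ‖g x‖ ^ 2) + ∫ x in G.interval e, density p 0 ‖f x‖ := by
  have hdens : ∀ t, density p 0 t = 1 / (p + 1) * t ^ (p + 1) := fun t => by simp [density]
  rcases eq_or_ne (f 0) 0 with h0 | h0
  · refine ⟨fun _ => 0, fun _ => 0, hasL2DerivOn_zero _, h0.symm, ?_⟩
    have h1 : 0 ≤ ∫ x in G.interval e, ‖g x‖ ^ 2 := integral_nonneg fun _ => sq_nonneg _
    have h2 : 0 ≤ ∫ x in G.interval e, density p 0 ‖f x‖ :=
      integral_nonneg fun _ => density_nonneg hp le_rfl (norm_nonneg _)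
    simp only [norm_zero, density_zero hp, integral_zero]
    simp
    positivity
  set r := ‖f 0‖ with hr
  have hr0 : 0 < r := norm_pos_iff.2 h0
  -- The exponent and `c` come from `w'' = w^p` for `w = r(1+cx)^{-θ}`: the powers match when `θp =
  -- θ + 2`, the coefficients when `c²θ(θ+1) = r^{p-1}`.
  set θ : ℝ := 2 / (p - 1) with hθ
  have hp1 : 0 < p - 1 := by linarith
  have hθ0 : 0 < θ := by positivity
  -- Equivalent to `p < 5`: the condition for `w²`, which decays like `x^{-2θ}`, to be integrable.
  have hθ1 : 1 < 2 * θ := by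
    rw [hθ, mul_div_assoc', lt_div_iff₀ hp1]
    linarith
  have hθp : θ * p = θ + 2 := by
    rw [hθ]
    field_simp
    ring
  set c := √(r ^ (p - 1) / (θ * (θ + 1))) with hc
  have hc0 : 0 < c := by positivity
  have hc2 : c ^ 2 * (θ * (θ + 1)) = r ^ (p - 1) := by
    rw [hc, Real.sq_sqrt (by positivity)]
    field_simp
  have hpos : ∀ x : ℝ, 0 ≤ x → 0 < 1 + c * x := fun x hx => by positivity
  set w : ℝ → ℝ := fun x => r * (1 + c * x) ^ (-θ) with hw
  set w₁ : ℝ → ℝ := fun x => -(r * θ * c) * (1 + c * x) ^ (-θ - 1) with hw₁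
  have hlin : ∀ x : ℝ, HasDerivAt (fun x : ℝ => 1 + c * x) c x := fun x => by
    simpa using ((hasDerivAt_id x).const_mul c).const_add 1
  have hwd : ∀ x, 0 ≤ x → HasDerivAt w (w₁ x) x := fun x hx => by
    refine (((hlin x).rpow_const (p := -θ) (Or.inl (hpos x hx).ne')).const_mul r).congr_deriv ?_
    simp only [hw₁]
    ring
  have hw0 : ∀ x, 0 ≤ x → 0 ≤ w x := fun x hx => by
    have := hpos x hx
    positivity
  have hwp : ∀ x, 0 ≤ x → w x ^ p = r * θ * (θ + 1) * c ^ 2 * (1 + c * x) ^ (-θ - 2) := by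
    intro x hx
    have h1 := hpos x hx
    simp only [hw]
    rw [Real.mul_rpow hr0.le (by positivity), ← Real.rpow_mul h1.le]
    have h2 : -θ * p = -θ - 2 := by linarith
    have h3 : r ^ p = r * r ^ (p - 1) := by
      rw [← Real.rpow_one_add' hr0.le (by linarith)]
      congr 1
      ring
    rw [h2, h3, ← hc2]
    ring
  have hw₁d : ∀ x, 0 ≤ x → HasDerivAt w₁ (w x ^ p) x := fun x hx => by
    refine (((hlin x).rpow_const (p := -θ - 1) (Or.inl (hpos x hx).ne')).const_mul
      (-(r * θ * c))).congr_deriv ?_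
    rw [hwp x hx, show -θ - 1 - 1 = -θ - 2 by ring]
    ring
  have hwc : ContinuousOn w (Set.Ici 0) := fun x hx => (hwd x hx).continuousAt.continuousWithinAt
  have hw₁c : ContinuousOn w₁ (Set.Ici 0) := fun x hx =>
    (hw₁d x hx).continuousAt.continuousWithinAt
  have hwsq : ∀ x ∈ Set.Ioi (0 : ℝ), r ^ 2 * (1 + c * x) ^ (-(2 * θ)) = w x ^ 2 := fun x hx => by
    have h1 := hpos x (le_of_lt hx)
    simp only [hw]
    rw [mul_pow, ← Real.rpow_mul_natCast h1.le]
    congr 2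
    push_cast
    ring
  have hw₁sq : ∀ x ∈ Set.Ioi (0 : ℝ),
      (r * θ * c) ^ 2 * (1 + c * x) ^ (-(2 * θ) - 2) = w₁ x ^ 2 := fun x hx => by
    have h1 := hpos x (le_of_lt hx)
    simp only [hw₁]
    rw [mul_pow (-(r * θ * c)), ← Real.rpow_mul_natCast h1.le, neg_sq]
    congr 2
    push_cast
    ring
  have hwpow : ∀ x ∈ Set.Ioi (0 : ℝ),
      1 / (p + 1) * (r ^ (p + 1) * (1 + c * x) ^ (-(2 * θ) - 2)) = density p 0 (w x) :=
    fun x hx => by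
      have h1 := hpos x (le_of_lt hx)
      rw [hdens]
      simp only [hw]
      rw [Real.mul_rpow hr0.le (by positivity), ← Real.rpow_mul h1.le]
      congr 3
      linarith
  have hi1 : IntegrableOn (fun x => w x ^ 2) (Set.Ioi 0) :=
    IntegrableOn.congr_fun ((integrableOn_one_add_mul_rpow (a := -(2 * θ)) hc0
      (by linarith)).const_mul (r ^ 2)) hwsq measurableSet_Ioi
  have hi := integrableOn_one_add_mul_rpow (a := -(2 * θ) - 2) hc0 (by linarith)
  have hi2 : IntegrableOn (fun x => w₁ x ^ 2) (Set.Ioi 0) :=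
    IntegrableOn.congr_fun (hi.const_mul _) hw₁sq measurableSet_Ioi
  have hi3 : IntegrableOn (fun x => density p 0 (w x)) (Set.Ioi 0) :=
    IntegrableOn.congr_fun ((hi.const_mul _).const_mul _) hwpow measurableSet_Ioi
  -- The phase of `f 0`. Only the real part `σ` of `conj z * f` is compared with `w`; it starts at
  -- `r` and passing to it increases neither `‖f‖` nor `‖g‖`.
  set z : ℂ := f 0 / r with hz
  have hz1 : ‖z‖ = 1 := by
    rw [hz, norm_div, Complex.norm_real, Real.norm_of_nonneg hr0.le, ← hr, div_self hr0.ne']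
  have hzr : z * r = f 0 := by
    rw [hz, div_mul_cancel₀]
    exact_mod_cast hr0.ne'
  have hnu : ∀ s : ℝ, ‖z * (s : ℂ)‖ = |s| := fun s => by
    rw [norm_mul, hz1, one_mul, Complex.norm_real, Real.norm_eq_abs]
  have hI := G.interval_eq_Ici he
  refine ⟨fun x => z * w x, fun x => z * w₁ x, ?_, ?_, ?_⟩
  · rw [hI]
    refine hasL2DerivOn_Ici_of_hasDerivAt (fun x hx => ((hwd x hx).ofReal_comp).const_mul z) ?_ ?_ ?_
    · exact continuousOn_const.mul (Complex.continuous_ofReal.comp_continuousOn hw₁c)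
    · simpa only [hnu, sq_abs] using hi1
    · simpa only [hnu, sq_abs] using hi2
  · simp [hw, hzr]
  have hg2 : IntegrableOn (fun x => ‖g x‖ ^ 2) (Set.Ioi 0) := by
    have := (memLp_two_iff_integrable_sq_norm h.1.1).1 h.1
    rw [hI] at this
    exact IntegrableOn.mono_set this Set.Ioi_subset_Ici_self
  have hf2 : IntegrableOn (fun x => density p 0 ‖f x‖) (Set.Ioi 0) := by
    rw [hI] at hf
    exact IntegrableOn.mono_set hf Set.Ioi_subset_Ici_self
  simp only [hnu, sq_abs]
  rw [hI]
  simp only [integral_Ici_eq_integral_Ioi]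
  have habs : ∫ x in Set.Ioi 0, density p 0 |w x| = ∫ x in Set.Ioi 0, density p 0 (w x) :=
    setIntegral_congr_fun measurableSet_Ioi fun x hx => by
      simp only [abs_of_nonneg (hw0 x (le_of_lt hx))]
  rw [habs, ← integral_const_mul, ← integral_const_mul, ← integral_add (hi2.const_mul _) hi3,
    ← integral_add (hg2.const_mul _) hf2]
  set D := ∫ t in G.interval e, ‖g t‖ ^ 2
  have hD0 : 0 ≤ D := integral_nonneg fun _ => sq_nonneg _
  set σ : ℝ → ℝ := fun x => ((starRingEnd ℂ) z * f x).re with hσ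
  set γ : ℝ → ℝ := fun x => ((starRingEnd ℂ) z * g x).re with hγ
  have hre : ∀ y : ℂ, |((starRingEnd ℂ) z * y).re| ≤ ‖y‖ := fun y => by
    refine (Complex.abs_re_le_norm _).trans ?_
    rw [norm_mul, RCLike.norm_conj, hz1, one_mul]
  have hσ0 : σ 0 = r := by
    simp only [hσ]
    rw [← hzr, ← mul_assoc, Complex.conj_mul', hz1]
    simp
  -- Convexity bounds the right side below by the value at `w` plus the first variation. Since `w''
  -- = w^p`, that variation integrates to a boundary term, which vanishes at `0` because `σ 0 = w
  -- 0`.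
  have hfinite : ∀ R, 0 ≤ R →
      (∫ x in (0 : ℝ)..R, (1 / 2 * w₁ x ^ 2 + density p 0 (w x))) + w₁ R * (σ R - w R) ≤
        ∫ x in (0 : ℝ)..R, (1 / 2 * ‖g x‖ ^ 2 + density p 0 ‖f x‖) := by
    intro R hR
    have hsub : Set.Ioc 0 R ⊆ Set.Ioi 0 := Set.Ioc_subset_Ioi_self
    have hsubI : Set.Icc 0 R ⊆ Set.Ici 0 := Set.Icc_subset_Ici_self
    have hmem : ∀ x, 0 ≤ x → x ∈ G.interval e := fun x hx => by
      rw [hI]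
      exact hx
    have hgi : ∀ x, 0 ≤ x → IntervalIntegrable g volume 0 x := fun x hx =>
      G.intervalIntegrable_of_memLp h.1 (hmem x hx)
    have hγi : ∀ x, 0 ≤ x → IntervalIntegrable γ volume 0 x := fun x hx => by
      have := (hgi x hx).const_mul ((starRingEnd ℂ) z)
      exact ⟨this.1.re, this.2.re⟩
    have hw₁i : ∀ x, 0 ≤ x → IntervalIntegrable w₁ volume 0 x := fun x hx => by
      refine (hw₁c.mono ?_).intervalIntegrable
      rw [Set.uIcc_of_le hx]
      exact Set.Icc_subset_Ici_self
    have hprim : ∀ x, 0 ≤ x → ∫ t in (0 : ℝ)..x, (γ t - w₁ t) = σ x - w x := by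
      intro x hx
      rw [intervalIntegral.integral_sub (hγi x hx) (hw₁i x hx)]
      have h1 : ∫ t in (0 : ℝ)..x, w₁ t = w x - w 0 := by
        refine intervalIntegral.integral_eq_sub_of_hasDerivAt (fun y hy => ?_) (hw₁i x hx)
        rw [Set.uIcc_of_le hx] at hy
        exact hwd y hy.1
      have h2 : ∫ t in (0 : ℝ)..x, γ t = σ x - σ 0 := by
        have h3 : ∫ t in (0 : ℝ)..x, γ t = (∫ t in (0 : ℝ)..x, (starRingEnd ℂ) z * g t).re := by
          rw [intervalIntegral.integral_of_le hx, intervalIntegral.integral_of_le hx]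
          exact integral_re ((intervalIntegrable_iff_integrableOn_Ioc_of_le hx).1
            ((hgi x hx).const_mul _))
        rw [h3, intervalIntegral.integral_const_mul]
        simp only [hσ]
        rw [h.2 x (hmem x hx), mul_add, Complex.add_re]
        ring
      have h4 : w 0 = r := by simp [hw]
      rw [h1, h2, hσ0, h4]
      ring
    have hparts := integral_mul_add_mul_primitive hR (fun x hx => hw₁d x hx.1)
      ((hwc.mono hsubI).rpow_const fun x _ => Or.inr (by linarith))
      ((hγi R hR).sub (hw₁i R hR))
    have hσc : ContinuousOn σ (Set.Icc 0 R) := by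
      have h1 : ContinuousOn f (Set.Icc 0 R) := h.continuousOn.mono fun x hx => hmem x hx.1
      exact Complex.continuous_re.comp_continuousOn (continuousOn_const.mul h1)
    have hii : IntervalIntegrable (fun x => w₁ x * (γ x - w₁ x) + w x ^ p * (σ x - w x))
        volume 0 R := by
      refine ((((hγi R hR).sub (hw₁i R hR)).continuousOn_mul ?_)).add ?_
      · rw [Set.uIcc_of_le hR]
        exact hw₁c.mono hsubI
      · refine ContinuousOn.intervalIntegrable ?_
        rw [Set.uIcc_of_le hR]
        exact ((hwc.mono hsubI).rpow_const fun x _ => Or.inr (by linarith)).mul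
          (hσc.sub (hwc.mono hsubI))
    have hparts' : ∫ x in (0 : ℝ)..R, (w₁ x * (γ x - w₁ x) + w x ^ p * (σ x - w x)) =
        w₁ R * (σ R - w R) := by
      rw [← hprim R hR, ← hparts]
      refine intervalIntegral.integral_congr fun x hx => ?_
      rw [Set.uIcc_of_le hR] at hx
      simp only [hprim x hx.1]
    have hwi : IntervalIntegrable (fun x => 1 / 2 * w₁ x ^ 2 + density p 0 (w x)) volume 0 R :=
      (intervalIntegrable_iff_integrableOn_Ioc_of_le hR).2
        (IntegrableOn.mono_set ((hi2.const_mul _).add hi3) hsub)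
    have hfi : IntervalIntegrable (fun x => 1 / 2 * ‖g x‖ ^ 2 + density p 0 ‖f x‖) volume 0 R :=
      (intervalIntegrable_iff_integrableOn_Ioc_of_le hR).2
        (IntegrableOn.mono_set ((hg2.const_mul _).add hf2) hsub)
    rw [← hparts', ← intervalIntegral.integral_add hwi hii]
    refine intervalIntegral.integral_mono_on hR (hwi.add hii) hfi fun x hx => ?_
    have h1 := mul_rpow_sub_le hp (norm_nonneg (f x)) (hw0 x hx.1)
    have h2 : γ x ^ 2 ≤ ‖g x‖ ^ 2 := by
      rw [← sq_abs]
      exact pow_le_pow_left₀ (abs_nonneg _) (hre (g x)) 2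
    have h3 : σ x ≤ ‖f x‖ := (le_abs_self _).trans (hre (f x))
    have h4 := mul_le_mul_of_nonneg_left h3 (Real.rpow_nonneg (hw0 x hx.1) p)
    rw [hdens, hdens]
    nlinarith [sq_nonneg (γ x - w₁ x)]
  -- Finite Dirichlet integral lets `σ` grow at most like `√R`, while `w₁` decays at least like
  -- `1/R`; the product is `O(R^{-1/2})`.
  have hbdry : Tendsto (fun R => w₁ R * (σ R - w R)) atTop (𝓝 0) := by
    have h1 : Tendsto (fun R => r * θ * c * (√(D / c) + 2 * r) * (1 + c * R) ^ (-(1 / 2) : ℝ)) atTop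
        (𝓝 0) := by
      have h2 : Tendsto (fun R : ℝ => 1 + c * R) atTop atTop :=
        tendsto_atTop_add_const_left _ _ (tendsto_id.const_mul_atTop hc0)
      simpa using ((tendsto_rpow_neg_atTop (show (0 : ℝ) < 1 / 2 by norm_num)).comp h2).const_mul
        (r * θ * c * (√(D / c) + 2 * r))
    refine squeeze_zero_norm' ?_ h1
    filter_upwards [eventually_ge_atTop 0] with R hR
    have hk := hpos R hR
    have hk1 : 1 ≤ 1 + c * R := by
      have := mul_nonneg hc0.le hR
      linarith
    have h3 : |w₁ R| ≤ r * θ * c * (1 + c * R) ^ (-1 : ℝ) := by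
      simp only [hw₁]
      rw [abs_mul, abs_neg, abs_of_pos (by positivity : 0 < r * θ * c),
        abs_of_pos (Real.rpow_pos_of_pos hk _)]
      exact mul_le_mul_of_nonneg_left (Real.rpow_le_rpow_of_exponent_le hk1 (by linarith))
        (by positivity)
    have h4 : |w R| ≤ r * (1 + c * R) ^ (1 / 2 : ℝ) := by
      rw [abs_of_nonneg (hw0 R hR)]
      simp only [hw]
      exact mul_le_mul_of_nonneg_left (Real.rpow_le_rpow_of_exponent_le hk1 (by linarith))
        (by positivity)
    have h5 : |σ R| ≤ (√(D / c) + r) * (1 + c * R) ^ (1 / 2 : ℝ) := by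
      have h6 := h.norm_sub_sq_le (G.zero_mem_interval e)
        (show R ∈ G.interval e by rw [hI]; exact hR)
      rw [sub_zero, abs_of_nonneg hR] at h6
      have h7 : ‖f R - f 0‖ ≤ √(D / c) * (1 + c * R) ^ (1 / 2 : ℝ) := by
        rw [← Real.sqrt_eq_rpow, ← Real.sqrt_mul (by positivity)]
        refine Real.le_sqrt_of_sq_le (h6.trans ?_)
        rw [div_mul_eq_mul_div, le_div_iff₀ hc0]
        nlinarith
      have h8 : ‖f R‖ ≤ ‖f R - f 0‖ + r := by
        simpa using norm_add_le (f R - f 0) (f 0)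
      have h9 : 1 ≤ (1 + c * R) ^ (1 / 2 : ℝ) := Real.one_le_rpow hk1 (by norm_num)
      have h10 := (hre (f R)).trans h8
      nlinarith
    have h11 : (1 + c * R) ^ (-(1 / 2) : ℝ) =
        (1 + c * R) ^ (-1 : ℝ) * (1 + c * R) ^ (1 / 2 : ℝ) := by
      rw [← Real.rpow_add hk]
      norm_num
    rw [h11, norm_mul, Real.norm_eq_abs, Real.norm_eq_abs]
    have h12 : |σ R - w R| ≤ (√(D / c) + 2 * r) * (1 + c * R) ^ (1 / 2 : ℝ) := by
      refine (abs_sub _ _).trans ?_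
      linarith
    calc |w₁ R| * |σ R - w R| ≤ r * θ * c * (1 + c * R) ^ (-1 : ℝ) *
          ((√(D / c) + 2 * r) * (1 + c * R) ^ (1 / 2 : ℝ)) := by gcongr
      _ = _ := by ring
  have hlim1 := (intervalIntegral_tendsto_integral_Ioi 0 ((hi2.const_mul (1 / 2)).add hi3)
    tendsto_id).add hbdry
  have hlim2 := intervalIntegral_tendsto_integral_Ioi 0 ((hg2.const_mul (1 / 2)).add hf2)
    tendsto_id
  rw [add_zero] at hlim1
  refine le_of_tendsto_of_tendsto hlim1 hlim2 ?_
  filter_upwards [eventually_ge_atTop 0] with R hR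
  exact hfinite R hR

/-! ### Small amplitudes and test functions. -/

theorem exists_pos_mul_sq_add_mul_rpow_neg {p a b : ℝ} (hp : 1 < p) (ha : a < 0) :
    ∃ t : ℝ, 0 < t ∧ a * t ^ 2 + b * t ^ (p + 1) < 0 := by
  have h1 : Tendsto (fun t : ℝ => a + b * t ^ (p - 1)) (𝓝[>] 0) (𝓝 a) := by
    have h2 : ContinuousAt (fun t : ℝ => a + b * t ^ (p - 1)) 0 :=
      continuousAt_const.add (continuousAt_const.mul
        (Real.continuousAt_rpow_const _ _ (Or.inr (by linarith))))
    have h3 := h2.tendsto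
    rw [Real.zero_rpow (by linarith), mul_zero, add_zero] at h3
    exact h3.mono_left nhdsWithin_le_nhds
  obtain ⟨t, ht, ht0⟩ := ((h1.eventually_lt_const ha).and self_mem_nhdsWithin).exists
  have ht0 : 0 < t := ht0
  refine ⟨t, ht0, ?_⟩
  have h4 : t ^ (p + 1) = t ^ (p - 1) * t ^ 2 := by
    rw [← Real.rpow_natCast t 2, ← Real.rpow_add ht0]
    congr 1
    push_cast
    ring
  rw [h4]
  nlinarith [pow_pos ht0 2]

/-- The scaled profile `s λx e^{-λx}` on the half-line has finite energy. -/
theorem hasL2DerivOn_mul_exp {s l : ℝ} (hl : 0 < l) :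
    HasL2DerivOn (Set.Ici 0) (fun x => ((s * (l * x * Real.exp (-(l * x))) : ℝ) : ℂ))
      (fun x => ((s * l * ((1 - l * x) * Real.exp (-(l * x))) : ℝ) : ℂ)) := by
  have hexp : IntegrableOn (fun x : ℝ => Real.exp (-l * x)) (Set.Ioi 0) :=
    exp_neg_integrableOn_Ioi 0 hl
  have hle : ∀ x : ℝ, Real.exp (-(l * x)) = Real.exp (-(l * x) / 2) ^ 2 := fun x => by
    rw [← Real.exp_nat_mul]
    congr 1
    push_cast
    ring
  have hlin : ∀ y : ℝ, 0 ≤ y → y * Real.exp (-y / 2) ≤ 2 := fun y hy => by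
    have h1 := Real.add_one_le_exp (y / 2)
    have h2 : Real.exp (y / 2) * Real.exp (-y / 2) = 1 := by
      rw [← Real.exp_add]
      simp [neg_div]
    nlinarith [Real.exp_pos (-y / 2)]
  -- Half of the exponential absorbs the linear factor, via `y * exp (-y / 2) ≤ 2`; squaring leaves
  -- `exp (-(l * x))` as an integrable majorant up to a constant.
  have hbound : ∀ (a b c : ℝ) (F : ℝ → ℝ), Continuous F →
      (∀ x, F x = a * ((b + c * (l * x)) * Real.exp (-(l * x)))) →
      IntegrableOn (fun x => F x ^ 2) (Set.Ioi 0) := by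
    intro a b c F hFc hF
    refine Integrable.mono' (hexp.const_mul (a ^ 2 * (|b| + 2 * |c|) ^ 2))
      (by fun_prop) ?_
    filter_upwards [ae_restrict_mem measurableSet_Ioi] with x hx
    have hx : 0 < x := hx
    have hy : 0 ≤ l * x := by positivity
    rw [Real.norm_of_nonneg (sq_nonneg _), hF, neg_mul, hle, mul_pow, mul_assoc]
    refine mul_le_mul_of_nonneg_left ?_ (sq_nonneg a)
    set E := Real.exp (-(l * x) / 2) with hE
    have hE0 : 0 < E := Real.exp_pos _
    have hE1 : E ≤ 1 := Real.exp_le_one_iff.2 (by linarith)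
    have h1 : |(b + c * (l * x)) * E| ≤ |b| + 2 * |c| := by
      rw [add_mul]
      refine (abs_add_le _ _).trans (add_le_add ?_ ?_)
      · rw [abs_mul, abs_of_pos hE0]
        exact mul_le_of_le_one_right (abs_nonneg _) hE1
      · rw [mul_assoc, abs_mul, abs_of_nonneg (by positivity : 0 ≤ l * x * E), mul_comm]
        exact mul_le_mul_of_nonneg_right (hlin _ hy) (abs_nonneg _)
    calc ((b + c * (l * x)) * E ^ 2) ^ 2 = ((b + c * (l * x)) * E) ^ 2 * E ^ 2 := by ring
      _ ≤ (|b| + 2 * |c|) ^ 2 * E ^ 2 := by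
        refine mul_le_mul_of_nonneg_right ?_ (sq_nonneg _)
        rw [← sq_abs]
        exact pow_le_pow_left₀ (abs_nonneg _) h1 2
  refine hasL2DerivOn_Ici_of_hasDerivAt (fun x _ => HasDerivAt.ofReal_comp ?_)
    (by fun_prop) ?_ ?_
  · have h1 : HasDerivAt (fun x : ℝ => l * x) l x := by
      simpa using (hasDerivAt_id x).const_mul l
    refine ((h1.mul h1.neg.exp).const_mul s).congr_deriv ?_
    simp only [Pi.neg_apply]
    ring
  · simp only [Complex.norm_real, Real.norm_eq_abs, sq_abs]
    exact hbound s 0 1 _ (by fun_prop) fun x => by ring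
  · simp only [Complex.norm_real, Real.norm_eq_abs, sq_abs]
    exact hbound (s * l) 1 (-1) _ (by fun_prop) fun x => by ring

/-! ### The spectral bottom, scaling, and necessary conditions. -/

namespace MetricGraph

variable {V E : Type*} {G : MetricGraph V E}

/-- Edges have positive length, so continuous functions that agree almost everywhere on an edge
agree up to its endpoints. -/
theorem interval_subset_closure_interior (e : E) :
    G.interval e ⊆ closure (interior (G.interval e)) := by
  by_cases h : G.length e = ⊤
  · rw [G.interval_eq_Ici h, interior_Ici, closure_Ioi]
  · rw [G.interval_eq_Icc h, interior_Icc,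
      closure_Ioo (ENNReal.toReal_pos (G.length_pos e).ne' h).ne]

theorem HasDerivOnEdge.integral_norm_rpow_pos {e : E} {f g : ℝ → ℂ} (h : G.HasDerivOnEdge e f g)
    (hf : MemLp f 2 (volume.restrict (G.interval e))) {q : ℝ} (hq : 2 ≤ q)
    {x : ℝ} (hx : x ∈ G.interval e) (hfx : f x ≠ 0) : 0 < ∫ x in G.interval e, ‖f x‖ ^ q := by
  have h0 : ∀ x, 0 ≤ ‖f x‖ ^ q := fun x => Real.rpow_nonneg (norm_nonneg _) _
  refine lt_of_le_of_ne (integral_nonneg h0) fun heq => hfx ?_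
  have h1 := (integral_eq_zero_iff_of_nonneg h0 (h.integrable_norm_rpow hf hq)).1 heq.symm
  have h2 : f =ᵐ[volume.restrict (G.interval e)] fun _ => 0 := by
    filter_upwards [h1] with y hy
    exact norm_eq_zero.1 ((Real.rpow_eq_zero (norm_nonneg _) (by linarith)).1 hy)
  exact Measure.eqOn_of_ae_eq h2 h.continuousOn continuousOn_const
    (interval_subset_closure_interior e) hx

theorem hasL2DerivOn_zero_of_forall {ψ : E → ℝ → ℂ} (h : ∀ e, ∀ x ∈ G.interval e, ψ e x = 0)
    (e : E) : HasL2DerivOn (G.interval e) (ψ e) (fun _ => 0) := by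
  refine ⟨MemLp.zero.ae_eq ?_, MemLp.zero, fun x hx => ?_⟩
  · filter_upwards [ae_restrict_mem (G.measurableSet_interval e)] with x hx
    exact (h e x hx).symm
  · rw [h e x hx, h e 0 (G.zero_mem_interval e)]
    simp

theorem HasDerivOnEdge.memLp_of_finite {e : E} {f g : ℝ → ℂ} (h : G.HasDerivOnEdge e f g)
    (he : G.length e ≠ ⊤) : MemLp f 2 (volume.restrict (G.interval e)) := by
  have hI := G.interval_eq_Icc he
  have hc := h.continuousOn
  have hm := h.aestronglyMeasurable
  rw [hI] at hc hm ⊢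
  obtain ⟨C, hC⟩ := isCompact_Icc.exists_bound_of_continuousOn hc
  exact MemLp.of_bound hm C (by
    filter_upwards [ae_restrict_mem measurableSet_Icc] with x hx using hC x hx)

variable [Fintype E]

theorem lpPow_pos {B : ∀ v : V, Matrix (G.J v) (G.J v) ℂ} {ψ : E → ℝ → ℂ}
    (hψ : ψ ∈ G.formDomain B) (hne : ∃ e, ∃ x ∈ G.interval e, ψ e x ≠ 0) {q : ℝ} (hq : 2 ≤ q) :
    0 < G.lpPow q ψ := by
  obtain ⟨e, x, hx, hne⟩ := hne
  obtain ⟨g, hg⟩ := hψ.1 e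
  refine Finset.sum_pos' (fun _ _ => integral_nonneg fun _ => Real.rpow_nonneg (norm_nonneg _) _)
    ⟨e, Finset.mem_univ e, ?_⟩
  exact (hasL2DerivOn_iff.1 hg).2.integral_norm_rpow_pos hg.1 hq hx hne

theorem lpPow_mul {c : ℝ} (hc : 0 ≤ c) (q : ℝ) (ψ : E → ℝ → ℂ) :
    G.lpPow q (fun e x => (c : ℂ) * ψ e x) = c ^ q * G.lpPow q ψ := by
  rw [lpPow, lpPow, Finset.mul_sum]
  refine Finset.sum_congr rfl fun e _ => ?_
  rw [← integral_const_mul]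
  refine integral_congr_ae (Eventually.of_forall fun x => ?_)
  simp only [norm_mul, Complex.norm_real, Real.norm_of_nonneg hc]
  exact Real.mul_rpow hc (norm_nonneg _)

theorem lpPow_eq_zero_of_forall {ψ : E → ℝ → ℂ} (h : ∀ e, ∀ x ∈ G.interval e, ψ e x = 0) {q : ℝ}
    (hq : q ≠ 0) : G.lpPow q ψ = 0 := by
  refine Finset.sum_eq_zero fun e _ => ?_
  refine (setIntegral_congr_fun (G.measurableSet_interval e) (g := fun _ => 0) fun x hx => ?_).trans
    (by simp)
  simp [h e x hx, Real.zero_rpow hq]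

variable [Fintype V] (A B : ∀ v : V, Matrix (G.J v) (G.J v) ℂ)

theorem form_eq_zero_of_forall {ψ : E → ℝ → ℂ} (h : ∀ e, ∀ x ∈ G.interval e, ψ e x = 0) :
    G.form A B ψ = 0 := by
  rw [form_eq A B (hasL2DerivOn_zero_of_forall h)]
  have h1 : G.trace ψ = (0 : ℂ) • G.trace ψ := by
    ext (e | e)
    · simp [trace, h e 0 (G.zero_mem_interval e)]
    · simp [trace, h e.1 _ (G.length_mem_interval e.2)]
  rw [h1, bdryForm_smul]
  simp

theorem form_smul {ψ : E → ℝ → ℂ} (hψ : ψ ∈ G.formDomain B) (c : ℝ) :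
    G.form A B (fun e x => (c : ℂ) * ψ e x) = c ^ 2 * G.form A B ψ := by
  choose g hg using hψ.1
  rw [form_eq A B hg, form_eq A B fun e => hasL2DerivOn_smul (c : ℂ) (hg e), trace_smul,
    bdryForm_smul, mul_add, Finset.mul_sum]
  congr 1
  · refine Finset.sum_congr rfl fun e _ => ?_
    rw [← integral_const_mul]
    simp [mul_pow]
  · simp

theorem action_smul {p ω : ℝ} {ψ : E → ℝ → ℂ} (hψ : ψ ∈ G.formDomain B) {c : ℝ} (hc : 0 ≤ c) :
    G.action A B p ω (fun e x => (c : ℂ) * ψ e x) =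
      1 / 2 * (G.form A B ψ + ω * G.lpPow 2 ψ) * c ^ 2 +
        1 / (p + 1) * G.lpPow (p + 1) ψ * c ^ (p + 1) := by
  rw [action, energy, mass, form_smul A B hψ, lpPow_mul hc, lpPow_mul hc, Real.rpow_two]
  ring

/-- Homogeneity removes the normalization. The strict inequality excludes the zero function by
itself. -/
theorem specBottom_lt_iff (c : ℝ) :
    G.specBottom A B < (c : EReal) ↔ ∃ ψ ∈ G.formDomain B, G.form A B ψ < c * G.lpPow 2 ψ := by
  simp only [specBottom, iInf_lt_iff, EReal.coe_lt_coe_iff]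
  constructor
  · rintro ⟨ψ, ⟨hψ, h1⟩, h⟩
    exact ⟨ψ, hψ, by rwa [h1, mul_one]⟩
  · rintro ⟨ψ, hψ, h⟩
    have hne : ∃ e, ∃ x ∈ G.interval e, ψ e x ≠ 0 := by
      by_contra! h0
      rw [form_eq_zero_of_forall A B h0, lpPow_eq_zero_of_forall h0 two_ne_zero] at h
      simp at h
    have hpos := lpPow_pos hψ hne le_rfl
    set N := G.lpPow 2 ψ
    have hN : (√N)⁻¹ ^ 2 = N⁻¹ := by rw [inv_pow, Real.sq_sqrt hpos.le]
    refine ⟨_, ⟨G.smul_mem_formDomain B (((√N)⁻¹ : ℝ) : ℂ) hψ, ?_⟩, ?_⟩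
    · rw [lpPow_mul (by positivity), Real.rpow_two, hN, inv_mul_cancel₀ hpos.ne']
    · rw [form_smul A B hψ, hN, inv_mul_lt_iff₀ hpos]
      linarith

/-- Comparison with the zero function. The inequality is strict because the `L^{p+1}` term of a
nonzero function is positive. -/
theorem specBottom_lt_of_isActionGroundState {p ω : ℝ} (hp : 1 < p) {ψ : E → ℝ → ℂ}
    (h : G.IsActionGroundState A B p ω ψ) : G.specBottom A B < ((-ω : ℝ) : EReal) := by
  obtain ⟨hψ, hne, hmin⟩ := h
  have h1 := hmin (G.zero_mem_formDomain B)
  simp only [Set.mem_ofPred_eq] at h1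
  rw [action_zero A B hp, action, energy, mass] at h1
  have h2 := lpPow_pos hψ hne (show 2 ≤ p + 1 by linarith)
  have h3 : 0 < 1 / (p + 1) * G.lpPow (p + 1) ψ := by positivity
  exact (specBottom_lt_iff A B _).2 ⟨ψ, hψ, by linarith⟩

theorem exists_action_neg {p ω : ℝ} (hp : 1 < p) (h : G.specBottom A B < ((-ω : ℝ) : EReal)) :
    ∃ ψ ∈ G.formDomain B, G.action A B p ω ψ < 0 := by
  obtain ⟨ψ, hψ, h1⟩ := (specBottom_lt_iff A B _).1 h
  obtain ⟨t, ht0, ht⟩ := exists_pos_mul_sq_add_mul_rpow_neg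
    (a := 1 / 2 * (G.form A B ψ + ω * G.lpPow 2 ψ)) (b := 1 / (p + 1) * G.lpPow (p + 1) ψ) hp
    (by linarith)
  exact ⟨_, G.smul_mem_formDomain B t hψ, by rwa [action_smul A B hψ ht0.le]⟩

open Classical in
/-- A function supported on an infinite edge that vanishes at its endpoint. -/
theorem action_single {p ω : ℝ} (hp : 1 < p) {e : E} (he : G.length e = ⊤) {f g : ℝ → ℂ}
    (h : HasL2DerivOn (G.interval e) f g) (h0 : f 0 = 0) :
    (Pi.single e f : E → ℝ → ℂ) ∈ G.formDomain B ∧ G.action A B p ω (Pi.single e f) =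
      1 / 2 * (∫ x in G.interval e, ‖g x‖ ^ 2) + ∫ x in G.interval e, density p ω ‖f x‖ := by
  have hd : ∀ e', HasL2DerivOn (G.interval e') ((Pi.single e f : E → ℝ → ℂ) e')
      ((Pi.single e g : E → ℝ → ℂ) e') := by
    intro e'
    rcases eq_or_ne e' e with rfl | hne
    · simpa using h
    · simp only [Pi.single_eq_of_ne hne]
      exact hasL2DerivOn_zero _
  have htr : G.trace (Pi.single e f) = (0 : ℂ) • G.trace (Pi.single e f) := by
    ext (e' | e')
    · rcases eq_or_ne e' e with rfl | hne
      · simp [trace, h0]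
      · simp [trace, Pi.single_eq_of_ne hne]
    · have hne : e'.1 ≠ e := fun heq => e'.2 (heq ▸ he)
      simp [trace, Pi.single_eq_of_ne hne]
  refine ⟨⟨fun e' => ⟨_, hd e'⟩, fun v => ?_⟩, ?_⟩
  · rw [← atVertex_trace, htr, zero_smul]
    exact map_zero (G.projD B v)
  · rw [action_eq_pairAction A B hp ω hd, pairAction, htr, bdryForm_smul,
      Finset.sum_eq_single e, Finset.sum_eq_single e]
    · simp
    · intro e' _ hne
      simp [Pi.single_eq_of_ne hne, density_zero hp]
    · simp
    · intro e' _ hne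
      simp [Pi.single_eq_of_ne hne]
    · simp

/-- The profile `s * k (l * x)` on an infinite edge has gradient energy of order `l` and density
integral `T / l`. With `ω < 0` a small `s` makes `T` negative, so the action tends to `-∞` as `l →
0`. -/
theorem not_bddBelow_action (hG : G.NonCompact) {p ω : ℝ} (hp : 1 < p) (hω : ω < 0) (m : ℝ) :
    ∃ φ ∈ G.formDomain B, G.action A B p ω φ < m := by
  classical
  obtain ⟨e, he⟩ := hG
  have hI := G.interval_eq_Ici he
  by_contra! hm
  set k : ℝ → ℝ := fun x => x * Real.exp (-x) with hk
  have hk0 : ∀ x, 0 ≤ x → 0 ≤ k x := fun x hx => mul_nonneg hx (Real.exp_pos _).le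
  have hder : ∀ s l : ℝ, 0 < l → HasL2DerivOn (G.interval e)
      (fun x => ((s * k (l * x) : ℝ) : ℂ))
      (fun x => ((s * l * ((1 - l * x) * Real.exp (-(l * x))) : ℝ) : ℂ)) := fun s l hl => by
    rw [hI]
    exact hasL2DerivOn_mul_exp hl
  have h1 := hder 1 1 one_pos
  simp only [one_mul, mul_one] at h1
  have hq1 : ∀ q : ℝ, 2 ≤ q → IntegrableOn (fun x => k x ^ q) (Set.Ioi 0) := fun q hq => by
    have h2 := (hasL2DerivOn_iff.1 h1).2.integrable_norm_rpow h1.1 hq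
    rw [hI] at h2
    refine IntegrableOn.congr_fun (IntegrableOn.mono_set h2 Set.Ioi_subset_Ici_self) (fun x hx => ?_)
      measurableSet_Ioi
    simp only [Complex.norm_real, Real.norm_of_nonneg (hk0 x (le_of_lt hx))]
  have hN : 0 < ∫ x in Set.Ioi 0, k x ^ (2 : ℝ) := by
    have h2 := (hasL2DerivOn_iff.1 h1).2.integral_norm_rpow_pos h1.1 le_rfl
      (x := 1) (by rw [hI]; exact zero_le_one (α := ℝ)) (by simp [hk])
    rw [hI, integral_Ici_eq_integral_Ioi] at h2
    refine h2.trans_eq (setIntegral_congr_fun measurableSet_Ioi fun x hx => ?_)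
    simp only [Complex.norm_real, Real.norm_of_nonneg (hk0 x (le_of_lt hx))]
  obtain ⟨s, hs0, hs⟩ := exists_pos_mul_sq_add_mul_rpow_neg
    (a := ω / 2 * ∫ x in Set.Ioi 0, k x ^ (2 : ℝ))
    (b := 1 / (p + 1) * ∫ x in Set.Ioi 0, k x ^ (p + 1)) hp
    (mul_neg_of_neg_of_pos (by linarith) hN)
  set T := ∫ x in Set.Ioi 0, density p ω (s * k x) with hT
  have hT0 : T < 0 := by
    refine lt_of_eq_of_lt ?_ hs
    have h2 : T = ∫ x in Set.Ioi 0, (1 / (p + 1) * s ^ (p + 1) * k x ^ (p + 1) +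
        ω / 2 * s ^ 2 * k x ^ (2 : ℝ)) := by
      refine setIntegral_congr_fun measurableSet_Ioi fun x hx => ?_
      simp only [density]
      rw [Real.mul_rpow hs0.le (hk0 x (le_of_lt hx)), Real.rpow_two]
      ring
    rw [h2, integral_add ((hq1 _ (by linarith)).const_mul _) ((hq1 _ le_rfl).const_mul _),
      integral_const_mul, integral_const_mul]
    ring
  set D := ∫ x in Set.Ioi 0, ((1 - x) * Real.exp (-x)) ^ 2
  -- Multiplying by `l` keeps both sides finite as `l → 0`; the limit would read `0 ≤ T`.
  have hineq : ∀ l : ℝ, 0 < l → l * m ≤ 1 / 2 * (s ^ 2 * l ^ 2 * D) + T := by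
    intro l hl
    obtain ⟨hmem, heq⟩ := action_single A B (ω := ω) hp he (hder s l hl) (by simp [hk])
    have h2 := hm _ hmem
    rw [heq, hI, integral_Ici_eq_integral_Ioi, integral_Ici_eq_integral_Ioi] at h2
    have h3 : ∫ x in Set.Ioi 0, ‖((s * l * ((1 - l * x) * Real.exp (-(l * x))) : ℝ) : ℂ)‖ ^ 2 =
        s ^ 2 * l ^ 2 * (l⁻¹ * D) := by
      have h4 := integral_comp_mul_left_Ioi (fun x => ((1 - x) * Real.exp (-x)) ^ 2) 0 hl
      rw [mul_zero, smul_eq_mul] at h4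
      rw [← h4, ← integral_const_mul]
      refine setIntegral_congr_fun measurableSet_Ioi fun x _ => ?_
      simp only [Complex.norm_real, Real.norm_eq_abs, sq_abs]
      ring
    have h5 : ∫ x in Set.Ioi 0, density p ω ‖((s * k (l * x) : ℝ) : ℂ)‖ = l⁻¹ * T := by
      have h4 := integral_comp_mul_left_Ioi (fun x => density p ω (s * k x)) 0 hl
      rw [mul_zero, smul_eq_mul] at h4
      rw [hT, ← h4]
      refine setIntegral_congr_fun measurableSet_Ioi fun x hx => ?_
      have hx : 0 < x := hx
      have := hk0 (l * x) (by positivity)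
      simp only [Complex.norm_real, Real.norm_of_nonneg (mul_nonneg hs0.le this)]
    rw [h3, h5] at h2
    have h6 := mul_le_mul_of_nonneg_left h2 hl.le
    refine h6.trans_eq ?_
    field_simp
  have hlim1 : Tendsto (fun l : ℝ => l * m) (𝓝[>] 0) (𝓝 0) := by
    have : Continuous fun l : ℝ => l * m := by fun_prop
    simpa using (this.tendsto 0).mono_left nhdsWithin_le_nhds
  have hlim2 : Tendsto (fun l : ℝ => 1 / 2 * (s ^ 2 * l ^ 2 * D) + T) (𝓝[>] 0) (𝓝 T) := by
    have : Continuous fun l : ℝ => 1 / 2 * (s ^ 2 * l ^ 2 * D) + T := by fun_prop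
    simpa using (this.tendsto 0).mono_left nhdsWithin_le_nhds
  have := le_of_tendsto_of_tendsto hlim1 hlim2 (by
    filter_upwards [self_mem_nhdsWithin] with l hl
    exact hineq l hl)
  linarith

/-! ### From relaxed minimizers to ground states. -/

theorem exists_minimizer_of_pos {p ω : ℝ} (hp : 1 < p) (hω : 0 < ω) :
    ∃ ψ ∈ G.formDomain B, IsMinOn (G.action A B p ω) (G.formDomain B) ψ := by
  obtain ⟨ψ, g, hd, hP, hint, hmin⟩ := exists_relaxed_minimizer A B hp hω.le
  have hL2 : ∀ e, HasL2DerivOn (G.interval e) (ψ e) (g e) := fun e => by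
    refine hasL2DerivOn_iff.2 ⟨?_, hd e⟩
    refine (memLp_two_iff_integrable_sq_norm (hd e).aestronglyMeasurable).2 ?_
    refine ((hint e).const_mul (2 / ω)).mono' ((hd e).aestronglyMeasurable.norm.pow 2)
      (Eventually.of_forall fun x => ?_)
    have h0 : 0 ≤ 1 / (p + 1) * ‖ψ e x‖ ^ (p + 1) := by positivity
    rw [Real.norm_of_nonneg (sq_nonneg _), density, mul_add]
    have h1 : 2 / ω * (ω / 2 * ‖ψ e x‖ ^ 2) = ‖ψ e x‖ ^ 2 := by field_simp
    rw [h1]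
    have : 0 ≤ 2 / ω * (1 / (p + 1) * ‖ψ e x‖ ^ (p + 1)) := by positivity
    linarith
  refine ⟨ψ, ⟨fun e => ⟨_, hL2 e⟩, hP⟩, fun φ hφ => ?_⟩
  simp only [Set.mem_ofPred_eq]
  rw [action_eq_pairAction A B hp ω hL2]
  exact hmin φ hφ

/-- Replacing the relaxed minimizer edge by edge is harmless: with the trace kept, the boundary form
is unchanged and the rest of the action is a sum over edges. -/
theorem exists_minimizer_of_zero {p : ℝ} (hp : 1 < p) (hp5 : p < 5) :
    ∃ ψ ∈ G.formDomain B, IsMinOn (G.action A B p 0) (G.formDomain B) ψ := by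
  obtain ⟨ψ, g, hd, hP, hint, hmin⟩ := exists_relaxed_minimizer A B hp le_rfl
  have hex : ∀ e, ∃ u u' : ℝ → ℂ, HasL2DerivOn (G.interval e) u u' ∧ u 0 = ψ e 0 ∧
      (G.length e ≠ ⊤ → u = ψ e) ∧
      1 / 2 * (∫ x in G.interval e, ‖u' x‖ ^ 2) + ∫ x in G.interval e, density p 0 ‖u x‖ ≤
      1 / 2 * (∫ x in G.interval e, ‖g e x‖ ^ 2) + ∫ x in G.interval e, density p 0 ‖ψ e x‖ := by
    intro e
    by_cases he : G.length e = ⊤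
    · obtain ⟨u, u', h1, h2, h3⟩ := (hd e).exists_profile he hp hp5 (hint e)
      exact ⟨u, u', h1, h2, fun h => absurd he h, h3⟩
    -- A finite edge has a second end whose value must be kept; there the function is already
    -- bounded, hence square integrable.
    · exact ⟨ψ e, g e, hasL2DerivOn_iff.2 ⟨(hd e).memLp_of_finite he, hd e⟩, rfl, fun _ => rfl,
        le_rfl⟩
  choose u u' hu hu0 hufin hule using hex
  have htr : G.trace u = G.trace ψ := by
    ext (e | e)
    · exact hu0 e
    · simp [trace, hufin e.1 e.2]
  refine ⟨u, ⟨fun e => ⟨_, hu e⟩, fun v => ?_⟩, fun φ hφ => ?_⟩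
  · rw [← atVertex_trace, htr]
    exact hP v
  · simp only [Set.mem_ofPred_eq]
    rw [action_eq_pairAction A B hp 0 hu]
    refine le_trans ?_ (hmin φ hφ)
    have h1 := Finset.sum_le_sum fun e (_ : e ∈ Finset.univ) => hule e
    rw [Finset.sum_add_distrib, Finset.sum_add_distrib, ← Finset.mul_sum, ← Finset.mul_sum] at h1
    rw [pairAction, pairAction, htr]
    linarith

/-- Some competitor has negative action, whereas a function vanishing on the graph has action `0`,
so the minimizer is nontrivial. -/
theorem exists_isActionGroundState {p ω : ℝ} (hp : 1 < p)
    (hmin : ∃ ψ ∈ G.formDomain B, IsMinOn (G.action A B p ω) (G.formDomain B) ψ)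
    (h : G.specBottom A B < ((-ω : ℝ) : EReal)) : ∃ ψ, G.IsActionGroundState A B p ω ψ := by
  obtain ⟨ψ, hψ, hm⟩ := hmin
  obtain ⟨φ, hφ, hneg⟩ := exists_action_neg A B hp h
  refine ⟨ψ, hψ, ?_, hm⟩
  by_contra! h0
  have h1 : G.action A B p ω ψ ≤ G.action A B p ω φ := hm hφ
  rw [action, energy, mass, form_eq_zero_of_forall A B h0, lpPow_eq_zero_of_forall h0 two_ne_zero,
    lpPow_eq_zero_of_forall h0 (by linarith)] at h1
  linarith

end MetricGraph

end

theorem theorem1p1 {V E : Type*} [Fintype V] [Fintype E] (G : MetricGraph V E)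
    (hG : G.NonCompact) (A B : ∀ v : V, Matrix (G.J v) (G.J v) ℂ)
    (hH : IsSelfAdjoint (G.hamiltonian A B)) (p : ℝ) (hp : 1 < p) :
    (∀ ω : ℝ, ω ≠ 0 →
      ((∃ ψ, G.IsActionGroundState A B p ω ψ) ↔
        G.specBottom A B < 0 ∧ 0 < ω ∧ (ω : EReal) < -G.specBottom A B)) ∧
    (p < 5 →
      ((∃ ψ, G.IsActionGroundState A B p 0 ψ) ↔ G.specBottom A B < 0)) := by
  refine ⟨fun ω hω => ⟨?_, ?_⟩, fun hp5 => ⟨?_, fun h => ?_⟩⟩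
  · rintro ⟨ψ, hψ⟩
    have h1 := MetricGraph.specBottom_lt_of_isActionGroundState A B hp hψ
    have hpos : 0 < ω := by
      refine lt_of_le_of_ne (not_lt.1 fun hneg => ?_) hω.symm
      obtain ⟨φ, hφ, hlt⟩ := MetricGraph.not_bddBelow_action A B hG hp hneg (G.action A B p ω ψ)
      exact absurd (hψ.2.2 hφ) (not_le.2 hlt)
    refine ⟨h1.trans ?_, hpos, ?_⟩
    · rw [← EReal.coe_zero, EReal.coe_lt_coe_iff]
      linarith
    · rw [EReal.lt_neg_comm]
      exact h1
  · rintro ⟨-, hpos, h⟩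
    rw [EReal.lt_neg_comm] at h
    exact MetricGraph.exists_isActionGroundState A B hp
      (MetricGraph.exists_minimizer_of_pos A B hp hpos) h
  · rintro ⟨ψ, hψ⟩
    simpa using MetricGraph.specBottom_lt_of_isActionGroundState A B hp hψ
  · exact MetricGraph.exists_isActionGroundState A B hp
      (MetricGraph.exists_minimizer_of_zero A B hp hp5) (by simpa using h)
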